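/- Let $\mathbb F$ be a field and let $(C,d,\mathcal F)$ be a chain complex of $\mathbb F$-vector spaces $C=\bigoplus_{n\in\mathbb Z}C_n$, $d(C_n)\subseteq C_{n-1}$, with an ascending $\mathbb Z$-filtration by subspaces $\mathcal F^pC_n$ such that $d(\mathcal F^pC_n)\subseteq\mathcal F^pC_{n-1}$. Assume that for each $n$ there is $p$ with $\mathcal F^pC_n=0$, and that $\dim_{\mathbb F}\mathcal F^pC_n<\infty$ for all $p,n$. Let $PC=\bigoplus_{p\in\mathbb Z}\mathcal F^pC$ be the persistent chain complex, a complex of graded $\mathbb F[x]$-modules ($\deg x=1$) on which $x$ acts by the inclusions $\mathcal F^pC\hookrightarrow\mathcal F^{p+1}C$, and let $PH=H(PC)$. For $r\ge 1$ let $E^{(r)}$ be the $E$-term of the exact couple obtained by deriving $r-1$ times the exact couple $$H(PC)\xrightarrow{\;x\;}H(PC)\longrightarrow H(PC/xPC)\xrightarrow{\;\Delta\;}H(PC)$$ induced by $0\to PC\{1\}\xrightarrow{x}PC\to PC/xPC\to0$, and let $E^{(r)}_{n,s}$ be its component of homological degree $n$ and module degree $s$. For $n,s\in\mathbb Z$ let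 $U_{n,s,\infty}$ be the complex $\mathbb F[x]$ concentrated in homological degree $n$ with generator in module degree $s$, and for a positive integer $m$ let $U_{n,s,m}$ be the complex $\mathbb F[x]\xrightarrow{x^m}\mathbb F[x]$ in homological degrees $n+1,n$ with generators in module degrees $s+m,s$ respectively. Then there are, for every $n\in\mathbb Z$, a number $K_n\in\{0,1,2,\dots\}\cup\{\infty\}$ and a lexicographically nondecreasing sequence $(s_n(i),m_n(i))_{1\le i\le K_n}$ ($i$ finite) in $\mathbb Z\times(\mathbb Z_{>0}\cup\{\infty\})$, taking each value of $s_n$ only finitely often, such that $$PH\cong\bigoplus_{n\in\mathbb Z}\ \bigoplus_{1\le i\le K_n}H\bigl(U_{n,s_n(i),m_n(i)}\bigr)$$ as bigraded $\mathbb F[x]$-modules. For any such decomposition put $\nu_{n,s,m}=\#\{i: 1\le i\le K_n,\ s_n(i)=s,\ m_n(i)=m\}$ for $m\in\mathbb Z_{>0}\cup\{\infty\}$. Then for every integer $r>0$ and all $n,s\in\mathbb Z$ the space $E^{(r)}_{n,s}$ is finite dimensional, only finitely many terms of the following sum over integers $m\ge r$ are nonzero, and $$\dim_{\mathbb F}E^{(r)}_{n,s}=\nu_{n,s,\infty}+\sum_{m\ge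 r}\bigl(\nu_{n,s,m}+\nu_{n-1,s-m,m}\bigr).$$ -/

import Mathlib

open Polynomial

universe u v w

/-! ## Linear algebra -/

section LinearAlgebra

variable {F : Type*} [Field F]
variable {A B C A' B' C' : Type*}
variable [AddCommGroup A] [Module F A] [AddCommGroup B] [Module F B] [AddCommGroup C] [Module F C]
variable [AddCommGroup A'] [Module F A'] [AddCommGroup B'] [Module F B']
variable [AddCommGroup C'] [Module F C']

/-- The homology `ker b / im a` of `A → B → C` at `B` (used when `b ∘ a = 0`). -/
abbrev MidHomology (a : A →ₗ[F] B) (b : B →ₗ[F] C) : Type _ :=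
  LinearMap.ker b ⧸ (LinearMap.range a).submoduleOf (LinearMap.ker b)

namespace MidHomology

/-- The homology class of a cycle. -/
def mk (a : A →ₗ[F] B) (b : B →ₗ[F] C) : LinearMap.ker b →ₗ[F] MidHomology a b :=
  Submodule.mkQ _

theorem mk_surjective (a : A →ₗ[F] B) (b : B →ₗ[F] C) : Function.Surjective (mk a b) :=
  Submodule.mkQ_surjective _

theorem mk_eq_zero {a : A →ₗ[F] B} {b : B →ₗ[F] C} {z : LinearMap.ker b} :
    mk a b z = 0 ↔ ∃ y, a y = z := by
  refine (Submodule.Quotient.mk_eq_zero _).trans ?_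
  simp [Submodule.submoduleOf]

/-- The linear map induced on homology by a map sending cycles to cycles and boundaries to
boundaries. -/
def map {a : A →ₗ[F] B} {b : B →ₗ[F] C} {a' : A' →ₗ[F] B'} {b' : B' →ₗ[F] C'}
    (t : B →ₗ[F] B') (hk : ∀ z, b z = 0 → b' (t z) = 0) (hr : ∀ y, ∃ y', a' y' = t (a y)) :
    MidHomology a b →ₗ[F] MidHomology a' b' :=
  Submodule.mapQ _ _ (t.restrict (p := LinearMap.ker b) (q := LinearMap.ker b') hk) (by
    rintro ⟨z, hz⟩ ⟨y, hy⟩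
    obtain ⟨y', hy'⟩ := hr y
    exact ⟨y', by rw [hy', hy]; rfl⟩)

theorem map_mk {a : A →ₗ[F] B} {b : B →ₗ[F] C} {a' : A' →ₗ[F] B'} {b' : B' →ₗ[F] C'}
    (t : B →ₗ[F] B') (hk : ∀ z, b z = 0 → b' (t z) = 0) (hr : ∀ y, ∃ y', a' y' = t (a y))
    (z : LinearMap.ker b) :
    map (a := a) (a' := a') t hk hr (mk a b z) = mk a' b' ⟨t z, hk z z.2⟩ := rfl

end MidHomology

/-- The linear map `B → C` through which `φ : A → C` factors along a surjection `π : A → B`. -/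
noncomputable def descend (π : A →ₗ[F] B) (hπ : Function.Surjective π) (φ : A →ₗ[F] C)
    (h : ∀ z, π z = 0 → φ z = 0) : B →ₗ[F] C :=
  (LinearMap.ker π).liftQ φ h ∘ₗ (π.quotKerEquivOfSurjective hπ).symm.toLinearMap

theorem descend_apply (π : A →ₗ[F] B) (hπ : Function.Surjective π) (φ : A →ₗ[F] C)
    (h : ∀ z, π z = 0 → φ z = 0) (z : A) : descend π hπ φ h (π z) = φ z := by
  have : (π.quotKerEquivOfSurjective hπ).symm (π z) = Submodule.Quotient.mk z := by
    rw [LinearEquiv.symm_apply_eq]; rfl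
  rw [descend, LinearMap.comp_apply, LinearEquiv.coe_coe, this]
  rfl

end LinearAlgebra

/-! ## Bigraded modules over `F[x]`

A graded module over `F[x]` with `deg x = 1` is given by its homogeneous components (vector
spaces indexed by `p : ℤ`) together with multiplication by `x`, a linear map from component `p`
to component `p + 1`.  A second index `n : ℤ` is the homological grading.  Multiplication by `x`
is indexed by pairs `p q` with a proof of `p + 1 = q`. -/

/-- A `ℤ × ℤ`-graded `F[x]`-module, given by its homogeneous components `X n p`
(homological degree `n`, module degree `p`) and by multiplication by `x`. -/
structure BigradedModule (F : Type u) [Field F] where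
  X : ℤ → ℤ → Type v
  [addCommGroup : ∀ n p, AddCommGroup (X n p)]
  [module : ∀ n p, Module F (X n p)]
  x : ∀ (n : ℤ) {p q : ℤ}, p + 1 = q → (X n p →ₗ[F] X n q)

attribute [instance] BigradedModule.addCommGroup BigradedModule.module

namespace BigradedModule

variable {F : Type u} [Field F]

/-- The direct sum of a family of bigraded `F[x]`-modules. -/
noncomputable def directSum {ι : Type} (M : ι → BigradedModule.{u, v} F) :
    BigradedModule.{u, v} F where
  X n p := DirectSum ι fun i => (M i).X n p
  x n _ _ h := DirectSum.lmap fun i => (M i).x n h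

/-- An isomorphism of bigraded `F[x]`-modules: linear isomorphisms of the homogeneous components
that commute with multiplication by `x`. -/
structure Iso (M : BigradedModule.{u, v} F) (N : BigradedModule.{u, w} F) where
  equiv : ∀ n p, M.X n p ≃ₗ[F] N.X n p
  comm : ∀ (n : ℤ) {p q : ℤ} (h : p + 1 = q) (z : M.X n p),
    equiv n q (M.x n h z) = N.x n h (equiv n p z)

end BigradedModule

/-! ## Chain complexes of graded `F[x]`-modules -/

/-- A chain complex of `x`-torsion-free graded `F[x]`-modules (for example, of free ones): a
bigraded `F[x]`-module with injective multiplication by `x` and with a differential that lowers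
the homological degree by one, preserves the module degree and is `F[x]`-linear.  As for
`HomologicalComplex`, the differential is given between all pairs of degrees and is required to
vanish unless `j + 1 = i`. -/
structure GradedComplex (F : Type u) [Field F] extends BigradedModule.{u, v} F where
  x_injective : ∀ (n : ℤ) {p q : ℤ} (h : p + 1 = q), Function.Injective (x n h)
  d : ∀ i j p : ℤ, X i p →ₗ[F] X j p
  shape : ∀ i j p : ℤ, j + 1 ≠ i → d i j p = 0
  d_d : ∀ (i j k p : ℤ) (z : X i p), d j k p (d i j p z) = 0
  d_x : ∀ (i j : ℤ) {p q : ℤ} (h : p + 1 = q) (z : X i p), d i j q (x i h z) = x j h (d i j p z)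

namespace GradedComplex

variable {F : Type u} [Field F] (K : GradedComplex.{u, v} F)

/-- The homology `H(K)`, a bigraded `F[x]`-module. -/
noncomputable def homology : BigradedModule.{u, v} F where
  X n p := MidHomology (K.d (n + 1) n p) (K.d n (n - 1) p)
  x n p q h := MidHomology.map (K.x n h)
    (fun z hz => by rw [K.d_x, hz, map_zero])
    (fun y => ⟨K.x (n + 1) h y, K.d_x _ _ h y⟩)

/-- The homology class of a cycle of `K`. -/
noncomputable def homologyMk (n p : ℤ) :
    LinearMap.ker (K.d n (n - 1) p) →ₗ[F] K.homology.X n p :=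
  MidHomology.mk (K.d (n + 1) n p) (K.d n (n - 1) p)

theorem homologyMk_surjective (n p : ℤ) : Function.Surjective (K.homologyMk n p) :=
  MidHomology.mk_surjective _ _

theorem homologyMk_eq_zero {n p : ℤ} {z : LinearMap.ker (K.d n (n - 1) p)} :
    K.homologyMk n p z = 0 ↔ ∃ y, K.d (n + 1) n p y = z :=
  MidHomology.mk_eq_zero

/-- The homogeneous component of `K / xK` in homological degree `n` and module degree `q`. -/
abbrev quotX (n q : ℤ) : Type v :=
  K.X n q ⧸ LinearMap.range (K.x n (sub_add_cancel q 1))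

/-- The differential of `K / xK`. -/
def quotD (i j q : ℤ) : K.quotX i q →ₗ[F] K.quotX j q :=
  Submodule.mapQ _ _ (K.d i j q) (by
    rintro _ ⟨y, rfl⟩
    exact ⟨K.d i j (q - 1) y, (K.d_x i j _ y).symm⟩)

/-- The quotient map `K → K / xK`. -/
def quotMk (n q : ℤ) : K.X n q →ₗ[F] K.quotX n q := Submodule.mkQ _

theorem quotMk_surjective (n q : ℤ) : Function.Surjective (K.quotMk n q) :=
  Submodule.mkQ_surjective _

theorem quotMk_eq_zero {n p q : ℤ} (h : p + 1 = q) (z : K.X n q) :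
    K.quotMk n q z = 0 ↔ ∃ y, K.x n h y = z := by
  obtain rfl : p = q - 1 := by omega
  simp [quotMk]

theorem quotD_quotMk (i j q : ℤ) (z : K.X i q) :
    K.quotD i j q (K.quotMk i q z) = K.quotMk j q (K.d i j q z) := rfl

/-- The component of `H(K / xK)` in homological degree `n` and module degree `q`. -/
abbrev quotHomology (n q : ℤ) : Type v :=
  MidHomology (K.quotD (n + 1) n q) (K.quotD n (n - 1) q)

/-- The map `H(K) → H(K / xK)` induced by the quotient map. -/
def quotMap (n q : ℤ) : K.homology.X n q →ₗ[F] K.quotHomology n q :=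
  MidHomology.map (K.quotMk n q)
    (fun z hz => by rw [quotD_quotMk, hz, map_zero])
    (fun y => ⟨K.quotMk _ q y, K.quotD_quotMk _ _ q y⟩)

/-- The elements of `K` that are cycles modulo `xK`. -/
def relCycles (n q : ℤ) : Submodule F (K.X n q) :=
  LinearMap.ker (K.quotMk (n - 1) q ∘ₗ K.d n (n - 1) q)

/-- The class in `H(K / xK)` of a cycle modulo `xK`. -/
def relClass (n q : ℤ) : K.relCycles n q →ₗ[F] K.quotHomology n q :=
  MidHomology.mk _ _ ∘ₗ (K.quotMk n q).restrict (p := K.relCycles n q)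
    (q := LinearMap.ker (K.quotD n (n - 1) q)) (fun _ hz => hz)

theorem relClass_surjective (n q : ℤ) : Function.Surjective (K.relClass n q) := by
  intro e
  obtain ⟨⟨z, hz⟩, rfl⟩ := MidHomology.mk_surjective _ _ e
  obtain ⟨z, rfl⟩ := K.quotMk_surjective n q z
  exact ⟨⟨z, hz⟩, rfl⟩

theorem relClass_eq_zero {n p q : ℤ} (hp : p + 1 = q) (z : K.relCycles n q) :
    K.relClass n q z = 0 ↔ ∃ y w, K.d (n + 1) n q y + K.x n hp w = z := by
  refine MidHomology.mk_eq_zero.trans ⟨?_, ?_⟩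
  · rintro ⟨y, hy⟩
    obtain ⟨y, rfl⟩ := K.quotMk_surjective _ q y
    have : K.quotMk n q (z - K.d (n + 1) n q y) = 0 := by
      rw [map_sub, sub_eq_zero, ← quotD_quotMk]; exact hy.symm
    obtain ⟨w, hw⟩ := (K.quotMk_eq_zero hp _).1 this
    exact ⟨y, w, by rw [hw]; abel⟩
  · rintro ⟨y, w, h⟩
    refine ⟨K.quotMk _ q y, ?_⟩
    change _ = K.quotMk n q (z : K.X n q)
    rw [quotD_quotMk, ← h, map_add, (K.quotMk_eq_zero hp (K.x n hp w)).2 ⟨w, rfl⟩, add_zero]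

/-- The differential, on cycles modulo `xK`, takes values in `xK`. -/
def relD {n n' p q : ℤ} (hn : n' + 1 = n) (hp : p + 1 = q) :
    K.relCycles n q →ₗ[F] LinearMap.range (K.x n' hp) :=
  (K.d n n' q).restrict (fun z hz => by
    obtain rfl : n' = n - 1 := by omega
    exact (K.quotMk_eq_zero hp _).1 hz)

/-- `z ↦ x⁻¹ (d z)` on cycles modulo `xK`, with values in `K`. -/
noncomputable def divD' {n n' p q : ℤ} (hn : n' + 1 = n) (hp : p + 1 = q) :
    K.relCycles n q →ₗ[F] K.X n' p :=
  (LinearEquiv.ofInjective (K.x n' hp) (K.x_injective n' hp)).symm.toLinearMap ∘ₗ K.relD hn hp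

theorem x_divD' {n n' p q : ℤ} (hn : n' + 1 = n) (hp : p + 1 = q) (z : K.relCycles n q) :
    K.x n' hp (K.divD' hn hp z) = K.d n n' q z :=
  congrArg Subtype.val
    ((LinearEquiv.ofInjective (K.x n' hp) (K.x_injective n' hp)).apply_symm_apply
      (K.relD hn hp z))

/-- `z ↦ x⁻¹ (d z)` on cycles modulo `xK`; its values are cycles of `K`. -/
noncomputable def divD {n n' p q : ℤ} (hn : n' + 1 = n) (hp : p + 1 = q) :
    K.relCycles n q →ₗ[F] LinearMap.ker (K.d n' (n' - 1) p) :=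
  LinearMap.codRestrict _ (K.divD' hn hp) (fun z => by
    refine K.x_injective (n' - 1) hp ?_
    rw [← K.d_x, map_zero, x_divD', K.d_d])

theorem x_divD {n n' p q : ℤ} (hn : n' + 1 = n) (hp : p + 1 = q) (z : K.relCycles n q) :
    K.x n' hp (K.divD hn hp z) = K.d n n' q z :=
  K.x_divD' hn hp z

/-- The connecting homomorphism `Δ : H_n(K / xK) → H_{n-1}(K{1})` of the short exact sequence
`0 → K{1} → K → K / xK → 0`, sending the class of `z` to the class of `x⁻¹ (d z)`. -/
noncomputable def connecting {n n' p q : ℤ} (hn : n' + 1 = n) (hp : p + 1 = q) :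
    K.quotHomology n q →ₗ[F] K.homology.X n' p :=
  descend (K.relClass n q) (K.relClass_surjective n q)
    (K.homologyMk n' p ∘ₗ K.divD hn hp) (by
      subst hn
      intro z hz
      obtain ⟨y, w, h⟩ := (K.relClass_eq_zero hp z).1 hz
      refine K.homologyMk_eq_zero.2 ⟨w, K.x_injective n' hp ?_⟩
      rw [x_divD, ← h, map_add, K.d_d, zero_add, K.d_x])

end GradedComplex

/-! ## Exact couples -/

/-- A bigraded exact couple with maps `f` of bidegree `(0, 1)`, `g` of bidegree `(0, -k)` and
`h` of bidegree `(-1, -1)`. -/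
structure ExactCouple (F : Type u) [Field F] where
  k : ℤ
  A : ℤ → ℤ → Type v
  E : ℤ → ℤ → Type v
  [addCommGroupA : ∀ n p, AddCommGroup (A n p)]
  [moduleA : ∀ n p, Module F (A n p)]
  [addCommGroupE : ∀ n p, AddCommGroup (E n p)]
  [moduleE : ∀ n p, Module F (E n p)]
  f : ∀ (n : ℤ) {p q : ℤ}, p + 1 = q → (A n p →ₗ[F] A n q)
  g : ∀ (n : ℤ) {p q : ℤ}, q + k = p → (A n p →ₗ[F] E n q)
  h : ∀ {n n' p q : ℤ}, n' + 1 = n → q + 1 = p → (E n p →ₗ[F] A n' q)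
  exact_f_g : ∀ (n : ℤ) {p q r : ℤ} (hf : p + 1 = q) (hg : r + k = q),
    Function.Exact (f n hf) (g n hg)
  exact_g_h : ∀ {n n' p q r : ℤ} (hg : q + k = p) (hn : n' + 1 = n) (hh : r + 1 = q),
    Function.Exact (g n hg) (h hn hh)
  exact_h_f : ∀ {n n' p q r : ℤ} (hn : n' + 1 = n) (hh : q + 1 = p) (hf : q + 1 = r),
    Function.Exact (h hn hh) (f n' hf)

attribute [instance] ExactCouple.addCommGroupA ExactCouple.moduleA
  ExactCouple.addCommGroupE ExactCouple.moduleE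

namespace ExactCouple

variable {F : Type u} [Field F] (X : ExactCouple.{u, v} F)

/-- The differential `d = g ∘ h` of `E`, of bidegree `(-1, -1 - k)`. -/
def d {n n' p q : ℤ} (hn : n' + 1 = n) (hq : q + X.k + 1 = p) : X.E n p →ₗ[F] X.E n' q :=
  X.g n' rfl ∘ₗ X.h hn hq

/-- `A' = f(A)`. -/
abbrev derivedA (n p : ℤ) : Type v := LinearMap.range (X.f n (sub_add_cancel p 1))

/-- `E' = ker d / im d`. -/
abbrev derivedE (n p : ℤ) : Type v :=
  MidHomology (X.d (n := n + 1) (n' := n) (p := p + X.k + 1) (q := p) rfl rfl)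
    (X.d (n := n) (n' := n - 1) (p := p) (q := p - X.k - 1) (by omega) (by omega))

/-- `f : A → A' = f(A)`. -/
def toDerivedA (n : ℤ) {p q : ℤ} (hf : p + 1 = q) : X.A n p →ₗ[F] X.derivedA n q :=
  LinearMap.codRestrict _ (X.f n hf) (fun a => by
    obtain rfl : p = q - 1 := by omega
    exact ⟨a, rfl⟩)

theorem toDerivedA_surjective (n : ℤ) {p q : ℤ} (hf : p + 1 = q) :
    Function.Surjective (X.toDerivedA n hf) := by
  obtain rfl : p = q - 1 := by omega
  rintro ⟨_, a, rfl⟩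
  exact ⟨a, rfl⟩

/-- The class in `E'` of `g(a)`. -/
def classG (n : ℤ) {p q : ℤ} (hg : q + X.k = p) : X.A n p →ₗ[F] X.derivedE n q :=
  MidHomology.mk _ _ ∘ₗ LinearMap.codRestrict _ (X.g n hg) (fun a => by
    change X.g _ _ (X.h _ _ (X.g n hg a)) = 0
    rw [(X.exact_g_h hg _ _).apply_apply_eq_zero, map_zero])

/-- `f' = f|_{A'}`. -/
def derivedF (n : ℤ) {p q : ℤ} (hf : p + 1 = q) : X.derivedA n p →ₗ[F] X.derivedA n q :=
  X.toDerivedA n hf ∘ₗ Submodule.subtype _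

/-- `g'(f(a)) = g(a) + d(E)`. -/
noncomputable def derivedG (n : ℤ) {p q : ℤ} (hg : q + (X.k + 1) = p) :
    X.derivedA n p →ₗ[F] X.derivedE n q :=
  descend (X.toDerivedA n (p := p - 1) (by omega)) (X.toDerivedA_surjective n _)
    (X.classG n (by omega)) (by
      intro a ha
      have hg' : q + X.k = p - 1 := by omega
      obtain ⟨e, rfl⟩ := (X.exact_h_f (n := n + 1) (p := p) rfl (sub_add_cancel p 1)
        (sub_add_cancel p 1) a).1 (congrArg Subtype.val ha)
      obtain rfl : p = q + X.k + 1 := by omega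
      refine MidHomology.mk_eq_zero.2 ⟨e, ?_⟩
      have key : ∀ (t t' : ℤ) (ht : t + 1 = q + X.k + 1) (ht' : t' + 1 = q + X.k + 1)
          (hgt : q + X.k = t) (hgt' : q + X.k = t'),
          X.g n hgt (X.h (n := n + 1) rfl ht e) = X.g n hgt' (X.h rfl ht' e) := by
        intro t t' ht ht' hgt hgt'
        obtain rfl : t = t' := by omega
        rfl
      exact key _ _ _ _ _ _)

theorem derivedG_apply (n : ℤ) {p q r : ℤ} (hg : q + (X.k + 1) = p) (hr : r + 1 = p)
    (hr' : q + X.k = r) (a : X.A n r) :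
    X.derivedG n hg (X.toDerivedA n hr a) = X.classG n hr' a := by
  obtain rfl : r = p - 1 := by omega
  exact descend_apply _ _ _ _ a

theorem d_eq {n n' p q t : ℤ} (hn : n' + 1 = n) (hq : q + X.k + 1 = p) (ht : t + 1 = p)
    (hg : q + X.k = t) (z : X.E n p) : X.d hn hq z = X.g n' hg (X.h hn ht z) := by
  subst hg
  rfl

theorem toDerivedA_coe (n : ℤ) {p q : ℤ} (hf : p + 1 = q) (a : X.A n p) :
    (X.toDerivedA n hf a : X.A n q) = X.f n hf a := rfl

theorem derivedA_mem (n : ℤ) {p q : ℤ} (hf : p + 1 = q) (v : X.derivedA n q) :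
    ∃ a, X.f n hf a = v := by
  obtain ⟨a, rfl⟩ := X.toDerivedA_surjective n hf v
  exact ⟨a, rfl⟩

/-- `h` maps cycles of `d` to `A' = f(A)`. -/
def cycleH {n n' p q : ℤ} (hn : n' + 1 = n) (hq : q + 1 = p) :
    LinearMap.ker (X.d (n := n) (n' := n - 1) (p := p) (q := p - X.k - 1) (by omega) (by omega))
      →ₗ[F] X.derivedA n' q :=
  (X.h hn hq).restrict (by
    intro e he
    obtain rfl : n' = n - 1 := by omega
    rw [LinearMap.mem_ker, X.d_eq _ _ hq (by omega)] at he
    exact (X.exact_f_g _ _ _ _).1 he)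

/-- `h'(b + d(E)) = h(b)`. -/
def derivedH {n n' p q : ℤ} (hn : n' + 1 = n) (hq : q + 1 = p) :
    X.derivedE n p →ₗ[F] X.derivedA n' q :=
  Submodule.liftQ _ (X.cycleH hn hq) (by
    rintro ⟨e, he⟩ ⟨e', rfl⟩
    exact Subtype.ext ((X.exact_g_h _ hn hq).apply_apply_eq_zero _))

theorem derivedH_mk_coe {n n' p q : ℤ} (hn : n' + 1 = n) (hq : q + 1 = p)
    (z : LinearMap.ker (X.d (n := n) (n' := n - 1) (p := p) (q := p - X.k - 1)
      (by omega) (by omega))) :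
    (X.derivedH hn hq (MidHomology.mk _ _ z) : X.A n' q) = X.h hn hq z := rfl

theorem classG_eq_zero (n : ℤ) {p q : ℤ} (hg : q + X.k = p) (a : X.A n p) :
    X.classG n hg a = 0 ↔ ∃ e, X.d (n := n + 1) (p := q + X.k + 1) rfl rfl e = X.g n hg a :=
  MidHomology.mk_eq_zero

theorem derived_exact_f_g (n : ℤ) {p q r : ℤ} (hf : p + 1 = q) (hg : r + (X.k + 1) = q) :
    Function.Exact (X.derivedF n hf) (X.derivedG n hg) := by
  intro b
  have hr : r + X.k = p := by omega
  constructor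
  · intro hb
    obtain ⟨a, rfl⟩ := X.toDerivedA_surjective n hf b
    rw [X.derivedG_apply n hg hf hr, classG_eq_zero] at hb
    obtain ⟨e, he⟩ := hb
    have hp : p + 1 = r + X.k + 1 := by omega
    rw [X.d_eq _ _ hp hr, eq_comm, ← sub_eq_zero, ← map_sub] at he
    obtain ⟨a', ha'⟩ := (X.exact_f_g n (sub_add_cancel p 1) hr _).1 he
    refine ⟨X.toDerivedA n (sub_add_cancel p 1) a', Subtype.ext ?_⟩
    change X.f n hf (X.f n _ a') = X.f n hf a
    rw [ha', map_sub, (X.exact_h_f rfl hp hf).apply_apply_eq_zero, sub_zero]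
  · rintro ⟨c, rfl⟩
    obtain ⟨a, ha⟩ := X.derivedA_mem n (sub_add_cancel p 1) c
    change X.derivedG n hg (X.toDerivedA n hf (c : X.A n p)) = 0
    rw [X.derivedG_apply n hg hf hr, classG_eq_zero]
    exact ⟨0, by rw [map_zero, ← ha, (X.exact_f_g n _ hr).apply_apply_eq_zero]⟩

theorem derived_exact_g_h {n n' p q r : ℤ} (hg : q + (X.k + 1) = p) (hn : n' + 1 = n)
    (hh : r + 1 = q) : Function.Exact (X.derivedG n hg) (X.derivedH hn hh) := by
  intro b
  have hp : q + X.k + 1 = p := by omega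
  constructor
  · intro hb
    obtain ⟨z, rfl⟩ := MidHomology.mk_surjective _ _ b
    obtain ⟨a, ha⟩ := (X.exact_g_h (rfl : q + X.k = _) hn hh _).1 (congrArg Subtype.val hb)
    refine ⟨X.toDerivedA n hp a, ?_⟩
    rw [X.derivedG_apply n hg hp rfl]
    exact congrArg (MidHomology.mk _ _) (Subtype.ext ha)
  · rintro ⟨c, rfl⟩
    obtain ⟨a, rfl⟩ := X.toDerivedA_surjective n hp c
    rw [X.derivedG_apply n hg hp rfl]
    exact Subtype.ext ((X.exact_g_h _ hn hh).apply_apply_eq_zero a)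

theorem derived_exact_h_f {n n' p q r : ℤ} (hn : n' + 1 = n) (hh : q + 1 = p) (hf : q + 1 = r) :
    Function.Exact (X.derivedH hn hh) (X.derivedF n' hf) := by
  intro b
  constructor
  · intro hb
    obtain ⟨z, hz⟩ := (X.exact_h_f hn hh hf _).1 (congrArg Subtype.val hb)
    obtain ⟨a, ha⟩ := X.derivedA_mem n' (sub_add_cancel q 1) b
    have hzk : z ∈ LinearMap.ker (X.d (n := n) (n' := n - 1) (p := p) (q := p - X.k - 1)
        (by omega) (by omega)) := by
      obtain rfl : n' = n - 1 := by omega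
      rw [LinearMap.mem_ker, X.d_eq _ _ hh (by omega), hz]
      change X.g _ _ (b : X.A (n - 1) q) = 0
      rw [← ha, (X.exact_f_g _ _ _).apply_apply_eq_zero]
    exact ⟨MidHomology.mk _ _ ⟨z, hzk⟩, Subtype.ext hz⟩
  · rintro ⟨c, rfl⟩
    obtain ⟨z, rfl⟩ := MidHomology.mk_surjective _ _ c
    exact Subtype.ext ((X.exact_h_f hn hh hf).apply_apply_eq_zero _)

/-- The derived exact couple `(A', E', f', g', h')`. -/
noncomputable def derive : ExactCouple.{u, v} F where
  k := X.k + 1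
  A := X.derivedA
  E := X.derivedE
  f := X.derivedF
  g := X.derivedG
  h := X.derivedH
  exact_f_g := X.derived_exact_f_g
  exact_g_h := X.derived_exact_g_h
  exact_h_f := X.derived_exact_h_f

end ExactCouple

namespace GradedComplex

variable {F : Type u} [Field F] (K : GradedComplex.{u, v} F)

theorem exact_x_quotMap (n : ℤ) {p q : ℤ} (hp : p + 1 = q) :
    Function.Exact (K.homology.x n hp) (K.quotMap n q) := by
  intro b
  constructor
  · intro hb
    obtain ⟨z, rfl⟩ := K.homologyMk_surjective _ _ b
    have hz : K.relClass n q ⟨z, by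
        change K.quotMk _ _ (K.d _ _ _ (z : K.X n q)) = 0
        rw [z.2, map_zero]⟩ = 0 := hb
    obtain ⟨y, w, h⟩ := (K.relClass_eq_zero hp _).1 hz
    have hw : w ∈ LinearMap.ker (K.d n (n - 1) p) := by
      refine K.x_injective _ hp ?_
      rw [map_zero, ← K.d_x]
      have := congrArg (K.d n (n - 1) q) h
      rw [map_add, K.d_d, zero_add] at this
      exact this.trans z.2
    refine ⟨K.homologyMk _ _ ⟨w, hw⟩, ?_⟩
    change K.homologyMk n q ⟨K.x n hp w, by
      rw [LinearMap.mem_ker, K.d_x, LinearMap.mem_ker.1 hw, map_zero]⟩ = _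
    rw [← sub_eq_zero, ← map_sub, homologyMk_eq_zero]
    exact ⟨-y, by
      rw [map_neg]
      change _ = K.x n hp w - (z : K.X n q)
      rw [← h]
      abel⟩
  · rintro ⟨c, rfl⟩
    obtain ⟨w, rfl⟩ := K.homologyMk_surjective _ _ c
    refine MidHomology.mk_eq_zero.2 ⟨0, ?_⟩
    rw [map_zero]
    exact ((K.quotMk_eq_zero hp _).2 ⟨(w : K.X n p), rfl⟩).symm

theorem connecting_relClass {n n' p q : ℤ} (hn : n' + 1 = n) (hp : p + 1 = q)
    (z : K.relCycles n q) :
    K.connecting hn hp (K.relClass n q z) = K.homologyMk n' p (K.divD hn hp z) :=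
  descend_apply _ _ _ _ z

theorem exact_quotMap_connecting {n n' p q : ℤ} (hn : n' + 1 = n) (hp : p + 1 = q) :
    Function.Exact (K.quotMap n q) (K.connecting hn hp) := by
  intro b
  constructor
  · intro hb
    obtain ⟨z, rfl⟩ := K.relClass_surjective n q b
    rw [connecting_relClass, homologyMk_eq_zero] at hb
    subst hn
    obtain ⟨y, hy⟩ := hb
    have hz : K.d (n' + 1) n' q (K.x (n' + 1) hp y) = K.d (n' + 1) n' q z := by
      rw [K.d_x, hy, x_divD]
    have hc : (z : K.X (n' + 1) q) - K.x (n' + 1) hp y ∈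
        LinearMap.ker (K.d (n' + 1) (n' + 1 - 1) q) := by
      rw [add_sub_cancel_right, LinearMap.mem_ker, map_sub, hz, sub_self]
    refine ⟨K.homologyMk _ _ ⟨_, hc⟩, ?_⟩
    refine congrArg (MidHomology.mk _ _) (Subtype.ext ?_)
    change K.quotMk _ q ((z : K.X (n' + 1) q) - K.x (n' + 1) hp y) = K.quotMk _ q z
    rw [map_sub, (K.quotMk_eq_zero hp (K.x (n' + 1) hp y)).2 ⟨y, rfl⟩, sub_zero]
  · rintro ⟨c, rfl⟩
    obtain ⟨w, rfl⟩ := K.homologyMk_surjective _ _ c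
    have hw : (w : K.X n q) ∈ K.relCycles n q := by
      change K.quotMk _ _ (K.d _ _ _ (w : K.X n q)) = 0
      rw [w.2, map_zero]
    change K.connecting hn hp (K.relClass n q ⟨w, hw⟩) = 0
    rw [connecting_relClass, homologyMk_eq_zero]
    refine ⟨0, K.x_injective n' hp ?_⟩
    rw [map_zero, map_zero, x_divD]
    obtain rfl : n' = n - 1 := by omega
    exact w.2.symm

theorem exact_connecting_x {n n' p q r : ℤ} (hn : n' + 1 = n) (hp : p + 1 = q)
    (hr : p + 1 = r) : Function.Exact (K.connecting hn hp) (K.homology.x n' hr) := by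
  obtain rfl : q = r := by omega
  subst hn
  intro b
  constructor
  · intro hb
    obtain ⟨w, rfl⟩ := K.homologyMk_surjective _ _ b
    obtain ⟨z, hz⟩ := (K.homologyMk_eq_zero (z := ⟨K.x n' hp w, by
      rw [LinearMap.mem_ker, K.d_x, LinearMap.mem_ker.1 w.2, map_zero]⟩)).1 hb
    change K.d (n' + 1) n' q z = K.x n' hp w at hz
    have hz' : z ∈ K.relCycles (n' + 1) q := by
      change K.quotMk _ _ (K.d _ _ _ z) = 0
      rw [add_sub_cancel_right, hz, K.quotMk_eq_zero hp]
      exact ⟨w, rfl⟩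
    refine ⟨K.relClass _ q ⟨z, hz'⟩, ?_⟩
    rw [connecting_relClass]
    refine congrArg (K.homologyMk _ _) (Subtype.ext (K.x_injective n' hp ?_))
    rw [x_divD, hz]
  · rintro ⟨e, rfl⟩
    obtain ⟨z, rfl⟩ := K.relClass_surjective _ q e
    rw [connecting_relClass]
    change K.homologyMk n' q ⟨K.x n' hp (K.divD rfl hp z), by
      rw [LinearMap.mem_ker, K.d_x, LinearMap.mem_ker.1 (K.divD rfl hp z).2, map_zero]⟩ = 0
    exact K.homologyMk_eq_zero.2 ⟨z, (K.x_divD rfl hp z).symm⟩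

/-- The exact couple `H(K) → H(K) → H(K / xK) → H(K)` with maps multiplication by `x`, the map
induced by the quotient map, and the connecting homomorphism. -/
noncomputable def exactCouple : ExactCouple.{u, v} F where
  k := 0
  A := K.homology.X
  E := K.quotHomology
  f := K.homology.x
  g n p q hpq := K.quotMap n q ∘ₗ
    (LinearEquiv.cast (R := F) (M := K.homology.X n)
      (show p = q by rw [← hpq, add_zero])).toLinearMap
  h := K.connecting
  exact_f_g := by
    intro n p q r hf hg
    obtain rfl : r = q := by omega
    exact K.exact_x_quotMap n hf
  exact_g_h := by
    intro n n' p q r hg hn hh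
    obtain rfl : q = p := by omega
    exact K.exact_quotMap_connecting hn hh
  exact_h_f := K.exact_connecting_x

/-- The `(n, s)` component of the `r`-th page (`r ≥ 1`) of the spectral sequence of `K`: the
`E`-term of the `(r - 1)`-fold derived exact couple. -/
abbrev page (r : ℕ) (n s : ℤ) : Type v :=
  (ExactCouple.derive^[r - 1] K.exactCouple).E n s

end GradedComplex

/-! ## The elementary complexes `U_{n,s,m}` -/

section Elementary

variable (F : Type u) [Field F]

/-- The homogeneous component of the graded module `F[x]‖n‖{s}` (free of rank one, generator in
homological degree `n` and module degree `s`) in homological degree `i` and module degree `p`: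
the polynomials all of whose monomials `x ^ j` have `s + j = p`, and `0` if `i ≠ n`. -/
def freeComponent (n s i p : ℤ) : Submodule F F[X] where
  carrier := {a | ∀ j : ℕ, a.coeff j ≠ 0 → i = n ∧ s + j = p}
  zero_mem' := by simp
  add_mem' := by
    intro a b ha hb j hj
    by_cases h : a.coeff j = 0
    · exact hb j (by simpa [h] using hj)
    · exact ha j h
  smul_mem' := by
    intro c a ha j hj
    refine ha j fun h => hj (by simp [h])

variable {F}

theorem X_pow_mul_mem {n s i p n' s' i' p' : ℤ} {a : F[X]} (ha : a ∈ freeComponent F n s i p)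
    (k : ℕ) (hi : i = n → i' = n') (hk : s' + k + (p - s) = p') :
    X ^ k * a ∈ freeComponent F n' s' i' p' := by
  intro j hj
  rw [coeff_X_pow_mul'] at hj
  split_ifs at hj with h
  · obtain ⟨h1, h2⟩ := ha _ hj
    exact ⟨hi h1, by omega⟩
  · exact absurd rfl hj

/-- Multiplication by `x ^ k` between homogeneous components. -/
noncomputable def mulXPow {n s i p n' s' i' p' : ℤ} (k : ℕ) (hi : i = n → i' = n')
    (hk : s' + k + (p - s) = p') : freeComponent F n s i p →ₗ[F] freeComponent F n' s' i' p' :=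
  (LinearMap.mulLeft F (X ^ k)).restrict fun _ ha => X_pow_mul_mem ha k hi hk

theorem mulXPow_injective {n s i p n' s' i' p' : ℤ} (k : ℕ) (hi : i = n → i' = n')
    (hk : s' + k + (p - s) = p') :
    Function.Injective (mulXPow (F := F) (n := n) (s := s) (i := i) (p := p) k hi hk) := by
  intro a b h
  exact Subtype.ext (mul_left_cancel₀ (pow_ne_zero k X_ne_zero) (congrArg Subtype.val h))

variable (F)

/-- `U_{n,s,∞} = (0 → F[x]‖n‖{s} → 0)`. -/
noncomputable def elementaryFree (n s : ℤ) : GradedComplex.{u, u} F where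
  X i p := freeComponent F n s i p
  x i p q h := mulXPow 1 id (by push_cast; omega)
  x_injective i p q h := mulXPow_injective 1 id (by push_cast; omega)
  d _ _ _ := 0
  shape _ _ _ _ := rfl
  d_d _ _ _ _ _ := rfl
  d_x _ _ _ _ _ _ := by simp

/-- `U_{n,s,m} = (0 → F[x]‖n+1‖{s+m} → F[x]‖n‖{s} → 0)` with differential `x ^ m`, for finite
`m`.  An element `(a, b)` consists of its part `a` in `F[x]‖n‖{s}` and its part `b` in
`F[x]‖n+1‖{s+m}`; the differential sends it to `(x ^ m * b, 0)`. -/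
noncomputable def elementaryTorsion (n s : ℤ) (m : ℕ) : GradedComplex.{u, u} F where
  X i p := freeComponent F n s i p × freeComponent F (n + 1) (s + m) i p
  x i p q h := (mulXPow 1 id (by push_cast; omega)).prodMap (mulXPow 1 id (by push_cast; omega))
  x_injective i p q h :=
    Function.Injective.prodMap (mulXPow_injective 1 id (by push_cast; omega))
      (mulXPow_injective 1 id (by push_cast; omega))
  d i j p :=
    if h : j + 1 = i then
      (mulXPow m (by omega) (by omega) : freeComponent F (n + 1) (s + m) i p →ₗ[F]
        freeComponent F n s j p).prod 0 ∘ₗ LinearMap.snd F _ _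
    else 0
  shape i j p h := dif_neg h
  d_d i j k p z := by
    split_ifs <;> simp
  d_x i j p q h z := by
    split_ifs with hij
    · refine Prod.ext (Subtype.ext ?_) (Subtype.ext ?_)
      · change X ^ m * (X ^ 1 * (z.2 : F[X])) = X ^ 1 * (X ^ m * (z.2 : F[X]))
        ring
      · simp
    · exact (map_zero (LinearMap.prodMap _ _)).symm

/-- The elementary complex `U_{n,s,m}` for `m ∈ ℕ ∪ {∞}`. -/
noncomputable def elementary (n s : ℤ) (m : ℕ∞) : GradedComplex.{u, u} F :=
  ENat.recTopCoe (elementaryFree F n s) (fun k => elementaryTorsion F n s k) m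

end Elementary

/-! ## Filtered chain complexes -/

/-- A chain complex of `F`-vector spaces, graded by `ℤ`, with an ascending `ℤ`-filtration by
subcomplexes. -/
structure FilteredComplex (F : Type u) [Field F] where
  C : ChainComplex (ModuleCat.{v} F) ℤ
  fil : ∀ n : ℤ, ℤ → Submodule F (C.X n)
  mono : ∀ n : ℤ, Monotone (fil n)
  d_mem : ∀ (i j p : ℤ), ∀ z ∈ fil i p, (C.d i j).hom z ∈ fil j p

namespace FilteredComplex

variable {F : Type u} [Field F] (C : FilteredComplex.{u, v} F)

/-- For each `n`, the filtration on `C_n` is bounded below. -/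
def BoundedBelow : Prop := ∀ n : ℤ, ∃ p : ℤ, C.fil n p = ⊥

/-- Every `F^p C_n` is finite dimensional. -/
def LocallyFinite : Prop := ∀ n p : ℤ, FiniteDimensional F (C.fil n p)

/-- The persistent chain complex `⊕_p F^p C`, on which `x` acts by the inclusions
`F^p C → F^{p+1} C`. -/
def persistentComplex : GradedComplex.{u, v} F where
  X n p := C.fil n p
  x n p q h := Submodule.inclusion (C.mono n (by omega))
  x_injective n p q h := Submodule.inclusion_injective _
  d i j p := (C.C.d i j).hom.restrict (C.d_mem i j p)
  shape i j p h := by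
    ext z
    simp [C.C.shape i j h]
  d_d i j k p z := by
    refine Subtype.ext ?_
    change (C.C.d j k).hom ((C.C.d i j).hom (z : C.C.X i)) = 0
    rw [← LinearMap.comp_apply, ← ModuleCat.hom_comp, C.C.d_comp_d]
    rfl
  d_x i j p q h z := rfl

/-- The persistent homology, a bigraded `F[x]`-module. -/
noncomputable def persistentHomology : BigradedModule.{u, v} F := C.persistentComplex.homology

/-- The `(n, s)` component of the `r`-th page of the spectral sequence of the filtered complex. -/
abbrev page (r : ℕ) (n s : ℤ) : Type v := C.persistentComplex.page r n s

end FilteredComplex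

/-! ## Decompositions of persistent homology -/

/-- For every `n`, a finite or infinite sequence `(s_n(i), m_n(i))`, `1 ≤ i ≤ K_n`, in
`ℤ × (ℤ_{>0} ∪ {∞})`, lexicographically nondecreasing and with finitely many terms for each value
of `s_n`.  The values of `s n i` and `m n i` outside `1 ≤ i ≤ K n` are irrelevant. -/
structure ElementarySequence where
  K : ℤ → ℕ∞
  s : ℤ → ℕ → ℤ
  m : ℤ → ℕ → ℕ∞
  m_pos : ∀ (n : ℤ) (i : ℕ), 1 ≤ i → (i : ℕ∞) ≤ K n → 0 < m n i
  finite : ∀ n c : ℤ, {i : ℕ | 1 ≤ i ∧ (i : ℕ∞) ≤ K n ∧ s n i = c}.Finite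
  s_le : ∀ (n : ℤ) (i : ℕ), 1 ≤ i → ((i + 1 : ℕ) : ℕ∞) ≤ K n → s n i ≤ s n (i + 1)
  m_le : ∀ (n : ℤ) (i : ℕ), 1 ≤ i → ((i + 1 : ℕ) : ℕ∞) ≤ K n → s n i = s n (i + 1) →
    m n i ≤ m n (i + 1)

namespace ElementarySequence

variable (S : ElementarySequence)

/-- All pairs `(n, i)` with `1 ≤ i ≤ K_n`. -/
abbrev Index : Type := Σ n : ℤ, {i : ℕ // 1 ≤ i ∧ (i : ℕ∞) ≤ S.K n}

/-- The multiplicity `ν_{n,s,m}`. -/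
noncomputable def multiplicity (n s : ℤ) (m : ℕ∞) : ℕ :=
  {i : ℕ | 1 ≤ i ∧ (i : ℕ∞) ≤ S.K n ∧ S.s n i = s ∧ S.m n i = m}.ncard

/-- `M ≅ ⊕_n ⊕_{1 ≤ i ≤ K_n} H(U_{n, s_n(i), m_n(i)})` as bigraded `F[x]`-modules. -/
def Decomposes {F : Type u} [Field F] (M : BigradedModule.{u, v} F) : Prop :=
  Nonempty (M.Iso (BigradedModule.directSum fun a : S.Index =>
    (elementary F a.1 (S.s a.1 a.2) (S.m a.1 a.2)).homology))

end ElementarySequence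

/-! A decomposition of a bigraded module `M` into homologies of elementary complexes amounts to an
`IntervalBasis`: a set of bars, each with a birth degree and a length in `ℕ∞`, such that the bars
alive in degree `p` index a basis of the component of degree `p`, and `x` sends each basis vector to
the next one of its bar, or to zero when the bar dies (`decomposes_iff`). Indeed `H(U_{n,s,m})` is a
single bar in homological degree `n`, alive for `s ≤ p < s + m`.

Existence is a structure theorem for graded `F[x]`-modules that are bounded below and finite
dimensional in each degree, but perhaps not finitely generated. For every degree `p` and order `m`,
generators are chosen that form a basis of the elements killed by `x ^ m`, modulo multiples of `x`
and elements killed by a smaller power. Their multiples span by induction on degree and order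
(`span_genMul`), and are independent because the lexicographically largest generator in a relation
can be isolated (`linearIndependent_genMul`). Only finitely many bars precede a given one, so they
can be listed in lexicographic order (`exists_monotone_enumeration`).

For the dimension, exactness makes `E` an extension of the kernel of one `f` by the cokernel of
another (`finrank_E`). After `r` derivations the `A`-term is `x ^ r H`
(`exists_iterate_derive_embedding`), so the dimension of page `r + 1` is a combination of ranks of
`x ^ r` and `x ^ (r + 1)` on `H` (`finrank_page`). The rank of a power of `x` counts the bars alive
at both ends. In the difference, the cokernel keeps the bars in homological degree `n` born at `s`
with length at least `r + 1`, and the kernel keeps those in degree `n - 1` dying at `s` with length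
at least `r + 1`. Any decomposition computes the same ranks, so the formula holds for all of them.
-/

/-- A bar born in degree `s` with length `m` is alive in degree `p`. -/
def Alive (s : ℤ) (m : ℕ∞) (p : ℤ) : Prop := s ≤ p ∧ ((p - s).toNat : ℕ∞) < m

namespace Alive

theorem of_le {s : ℤ} {m : ℕ∞} {p q : ℤ} (h : Alive s m q) (hs : s ≤ p) (hpq : p ≤ q) :
    Alive s m p :=
  ⟨hs, lt_of_le_of_lt (by exact_mod_cast Int.toNat_le_toNat (by omega)) h.2⟩

theorem birth {s : ℤ} {m : ℕ∞} (hm : 0 < m) : Alive s m s := ⟨le_rfl, by simpa using hm⟩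

end Alive

/-! ### Powers of `x`, interval bases and ranks -/

namespace BigradedModule

variable {F : Type u} [Field F] (M : BigradedModule.{u, v} F)

/-- Multiplication by `x ^ k`. -/
def xPow (n : ℤ) : ∀ (k : ℕ) {p q : ℤ}, p + k = q → (M.X n p →ₗ[F] M.X n q)
  | 0, p, q, h =>
    (LinearEquiv.cast (R := F) (M := M.X n) (show p = q by simpa using h)).toLinearMap
  | k + 1, p, q, h => M.x n (sub_add_cancel q 1) ∘ₗ xPow n k (by push_cast at h; omega)

variable {M} {n : ℤ}

theorem xPow_succ {k : ℕ} {p q r : ℤ} (h : p + k = q) (h' : q + 1 = r)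
    (h'' : p + (k + 1 : ℕ) = r) (z : M.X n p) :
    M.xPow n (k + 1) h'' z = M.x n h' (M.xPow n k h z) := by
  obtain rfl : q = r - 1 := by omega
  rfl

theorem xPow_add {j k : ℕ} {p q r : ℤ} (h : p + j = q) (h' : q + k = r)
    (h'' : p + (j + k : ℕ) = r) (z : M.X n p) :
    M.xPow n (j + k) h'' z = M.xPow n k h' (M.xPow n j h z) := by
  induction k generalizing r with
  | zero =>
    obtain rfl : q = r := by simpa using h'
    rfl
  | succ k ih =>
    rw [xPow_succ (q := r - 1) (by push_cast at h'; omega) (by omega) h', ← ih _ (by omega),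
      ← xPow_succ _ _ (by push_cast; omega)]
    rfl

variable (M) in
/-- Bases of the homogeneous components of `M` that exhibit `M` as a direct sum of intervals: the
bars in homological degree `n` are indexed by `ι n`, and those alive in module degree `p` form a
basis of `M.X n p`. -/
structure IntervalBasis (ι : ℤ → Type*) (birth : ∀ n, ι n → ℤ) (len : ∀ n, ι n → ℕ∞) where
  basis : ∀ n p, Module.Basis {a : ι n // Alive (birth n a) (len n a) p} F (M.X n p)
  x_alive : ∀ (n : ℤ) {p q : ℤ} (h : p + 1 = q) (a : ι n) (hp : Alive (birth n a) (len n a) p)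
    (hq : Alive (birth n a) (len n a) q), M.x n h (basis n p ⟨a, hp⟩) = basis n q ⟨a, hq⟩
  x_dead : ∀ (n : ℤ) {p q : ℤ} (h : p + 1 = q) (a : ι n) (hp : Alive (birth n a) (len n a) p),
    ¬ Alive (birth n a) (len n a) q → M.x n h (basis n p ⟨a, hp⟩) = 0

namespace IntervalBasis

variable {N : BigradedModule.{u, w} F} {ι ι' : ℤ → Type*} {birth : ∀ n, ι n → ℤ}
  {len : ∀ n, ι n → ℕ∞}

/-- Modules with the same bars are isomorphic. -/
noncomputable def iso (b : M.IntervalBasis ι birth len) (c : N.IntervalBasis ι birth len) :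
    M.Iso N where
  equiv n p := (b.basis n p).equiv (c.basis n p) (Equiv.refl _)
  comm n p q h z := by
    refine LinearMap.congr_fun (f := ((b.basis n q).equiv (c.basis n q) (Equiv.refl _)).toLinearMap
      ∘ₗ M.x n h) (g := N.x n h ∘ₗ ((b.basis n p).equiv (c.basis n p) (Equiv.refl _)).toLinearMap)
      ((b.basis n p).ext ?_) z
    rintro ⟨a, hp⟩
    by_cases hq : Alive (birth n a) (len n a) q
    · simp [b.x_alive n h a hp hq, c.x_alive n h a hp hq]
    · simp [b.x_dead n h a hp hq, c.x_dead n h a hp hq]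

/-- Transport of interval bases along an isomorphism. -/
noncomputable def ofIso (e : M.Iso N) (c : N.IntervalBasis ι birth len) :
    M.IntervalBasis ι birth len where
  basis n p := (c.basis n p).map (e.equiv n p).symm
  x_alive n p q h a hp hq := by
    apply (e.equiv n q).injective
    simp [e.comm, c.x_alive n h a hp hq]
  x_dead n p q h a hp hq := by
    apply (e.equiv n q).injective
    simp [e.comm, c.x_dead n h a hp hq]

/-- Change of the index types of an interval basis. -/
noncomputable def reindex (b : M.IntervalBasis ι birth len) (e : ∀ n, ι' n ≃ ι n) :
    M.IntervalBasis ι' (fun n a => birth n (e n a)) (fun n a => len n (e n a)) where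
  basis n p := (b.basis n p).reindex ((e n).subtypeEquiv fun _ => Iff.rfl).symm
  x_alive n p q h a hp hq := by
    simpa using b.x_alive n h (e n a) hp hq
  x_dead n p q h a hp hq := by
    simpa using b.x_dead n h (e n a) hp hq

variable (b : M.IntervalBasis ι birth len)

theorem xPow_alive {k : ℕ} {p q : ℤ} (h : p + k = q) (a : ι n)
    (hp : Alive (birth n a) (len n a) p) (hq : Alive (birth n a) (len n a) q) :
    M.xPow n k h (b.basis n p ⟨a, hp⟩) = b.basis n q ⟨a, hq⟩ := by
  induction k generalizing q with
  | zero =>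
    obtain rfl : p = q := by simpa using h
    rfl
  | succ k ih =>
    have hr : Alive (birth n a) (len n a) (q - 1) :=
      hq.of_le (hp.1.trans (by omega)) (by omega)
    rw [xPow_succ (q := q - 1) (by omega) (by omega), ih _ hr, b.x_alive n _ a hr hq]

theorem xPow_dead {k : ℕ} {p q : ℤ} (h : p + k = q) (a : ι n)
    (hp : Alive (birth n a) (len n a) p) (hq : ¬ Alive (birth n a) (len n a) q) :
    M.xPow n k h (b.basis n p ⟨a, hp⟩) = 0 := by
  induction k generalizing q with
  | zero =>
    obtain rfl : p = q := by simpa using h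
    exact absurd hp hq
  | succ k ih =>
    rw [xPow_succ (q := q - 1) (by omega) (by omega)]
    by_cases hr : Alive (birth n a) (len n a) (q - 1)
    · rw [b.xPow_alive _ a hp hr, b.x_dead n _ a hr hq]
    · rw [ih _ hr, map_zero]

/-- The rank of `x ^ k` is the number of bars alive at both ends. -/
theorem finrank_range_xPow (b : M.IntervalBasis ι birth len) {k : ℕ} {p q : ℤ} (h : p + k = q) :
    Module.finrank F (LinearMap.range (M.xPow n k h)) =
      {a : ι n | Alive (birth n a) (len n a) p ∧ Alive (birth n a) (len n a) q}.ncard := by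
  let v : {a : ι n // Alive (birth n a) (len n a) p ∧ Alive (birth n a) (len n a) q} → M.X n q :=
    fun a => b.basis n q ⟨a, a.2.2⟩
  have hv : LinearIndependent F v :=
    (b.basis n q).linearIndependent.comp
      (fun a : {a : ι n // Alive (birth n a) (len n a) p ∧ Alive (birth n a) (len n a) q} =>
        (⟨a, a.2.2⟩ : {a : ι n // Alive (birth n a) (len n a) q}))
      (fun a a' haa => by simpa [Subtype.ext_iff] using haa)
  -- Each basis vector goes to zero or to the basis vector of the same bar, so the range is spanned
  -- by part of a basis.
  have hr : LinearMap.range (M.xPow n k h) = Submodule.span F (Set.range v) := by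
    rw [LinearMap.range_eq_map, ← (b.basis n p).span_eq, Submodule.map_span, ← Set.range_comp]
    apply le_antisymm <;> rw [Submodule.span_le]
    · rintro _ ⟨⟨a, hp⟩, rfl⟩
      by_cases hq : Alive (birth n a) (len n a) q
      · exact Submodule.subset_span ⟨⟨a, hp, hq⟩, (b.xPow_alive h a hp hq).symm⟩
      · change M.xPow n k h _ ∈ Submodule.span F (Set.range v)
        rw [b.xPow_dead h a hp hq]
        exact zero_mem _
    · rintro _ ⟨⟨a, hp, hq⟩, rfl⟩
      exact Submodule.subset_span ⟨⟨a, hp⟩, b.xPow_alive h a hp hq⟩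
  rw [hr, Module.finrank_eq_nat_card_basis (Module.Basis.span hv)]
  -- `ncard` is by definition the `Nat.card` of the subtype, so no finiteness is needed.
  rfl

theorem finite_alive (b : M.IntervalBasis ι birth len) (p : ℤ) [FiniteDimensional F (M.X n p)] :
    {a : ι n | Alive (birth n a) (len n a) p}.Finite :=
  Set.finite_coe_iff.1 (Module.Finite.finite_basis (b.basis n p))

end IntervalBasis

end BigradedModule

/-! ### Structure theorem: homogeneous generators with torsion orders -/

namespace BigradedModule

variable {F : Type u} [Field F] (M : BigradedModule.{u, v} F) (n : ℤ)

/-- The elements annihilated by `x ^ m` (all elements if `m = ∞`). -/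
def torsion (p : ℤ) (m : ℕ∞) : Submodule F (M.X n p) where
  -- Quantifying over all `k ≥ m` rather than `k = m` alone makes the condition vacuous at `m = ∞`.
  carrier := {z | ∀ (k : ℕ) (q : ℤ) (h : p + k = q), m ≤ k → M.xPow n k h z = 0}
  zero_mem' := by simp
  add_mem' := by
    intro a b ha hb k q h hk
    rw [map_add, ha k q h hk, hb k q h hk, add_zero]
  smul_mem' := by
    intro c a ha k q h hk
    rw [map_smul, ha k q h hk, smul_zero]

variable {M n}

theorem torsion_top (p : ℤ) : M.torsion n p ⊤ = ⊤ := by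
  refine eq_top_iff.2 fun z _ k q h hk => ?_
  exact absurd hk (by simp)

theorem torsion_zero (p : ℤ) : M.torsion n p 0 = ⊥ :=
  eq_bot_iff.2 fun _ hz => hz 0 p (by simp) (by simp)

theorem mem_torsion {p q : ℤ} {k : ℕ} (h : p + k = q) {z : M.X n p}
    (hz : M.xPow n k h z = 0) : z ∈ M.torsion n p k := by
  intro j r hj hkj
  obtain ⟨i, rfl⟩ := Nat.exists_eq_add_of_le (show k ≤ j by exact_mod_cast hkj)
  rw [xPow_add h (by push_cast at hj; omega), hz, map_zero]

variable (M n)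

/-- The elements of degree `p` that are sums of a multiple of `x` and of elements annihilated by
smaller powers of `x` than the `m`-th. -/
def subTorsion (p : ℤ) (m : ℕ∞) : Submodule F (M.X n p) :=
  LinearMap.range (M.x n (sub_add_cancel p 1)) ⊔ ⨆ k < m, M.torsion n p k

/-- The space of generators of degree `p` and order `x ^ m`. -/
abbrev primitive (p : ℤ) (m : ℕ∞) : Submodule F (M.X n p ⧸ M.subTorsion n p m) :=
  (M.torsion n p m).map (M.subTorsion n p m).mkQ

/-- Indices for a homogeneous set of generators with torsion orders. -/
abbrev GenIndex : Type := Σ k : ℤ × ℕ∞, Fin (Module.finrank F (M.primitive n k.1 k.2))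

variable {M n}

theorem x_mem_subTorsion {p q : ℤ} (h : p + 1 = q) (m : ℕ∞) (z : M.X n p) :
    M.x n h z ∈ M.subTorsion n q m := by
  obtain rfl : p = q - 1 := by omega
  exact Submodule.mem_sup_left ⟨z, rfl⟩

theorem torsion_le_subTorsion (p : ℤ) {k m : ℕ∞} (h : k < m) :
    M.torsion n p k ≤ M.subTorsion n p m :=
  le_sup_of_le_right (le_iSup₂_of_le k h le_rfl)

theorem GenIndex.len_pos (a : M.GenIndex n) : 0 < a.1.2 := by
  obtain ⟨⟨p, m⟩, i⟩ := a
  refine pos_iff_ne_zero.2 ?_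
  rintro rfl
  have : M.primitive n p 0 = ⊥ := by rw [primitive, torsion_zero, Submodule.map_bot]
  rw [this, finrank_bot] at i
  exact i.elim0

variable [∀ p, FiniteDimensional F (M.X n p)]

theorem exists_gen (a : M.GenIndex n) : ∃ z ∈ M.torsion n a.1.1 a.1.2,
    (M.subTorsion n a.1.1 a.1.2).mkQ z = Module.finBasis F (M.primitive n a.1.1 a.1.2) a.2 :=
  Submodule.mem_map.1 (Module.finBasis F (M.primitive n a.1.1 a.1.2) a.2).2

variable (M n) in
/-- Homogeneous generators. -/
noncomputable def gen (a : M.GenIndex n) : M.X n a.1.1 := (exists_gen a).choose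

theorem gen_mem (a : M.GenIndex n) : M.gen n a ∈ M.torsion n a.1.1 a.1.2 :=
  (exists_gen a).choose_spec.1

theorem mkQ_gen (a : M.GenIndex n) : (M.subTorsion n a.1.1 a.1.2).mkQ (M.gen n a) =
    Module.finBasis F (M.primitive n a.1.1 a.1.2) a.2 :=
  (exists_gen a).choose_spec.2

/-- A coordinate of the chosen basis of `primitive`, extended to the whole quotient and pulled back.
It reads off the coefficient of one generator in the proof of linear independence. -/
theorem exists_functional {p : ℤ} {m : ℕ∞}
    (i : Fin (Module.finrank F (M.primitive n p m))) :
    ∃ φ : M.X n p →ₗ[F] F, (∀ z ∈ M.subTorsion n p m, φ z = 0) ∧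
      ∀ j, φ (M.gen n ⟨(p, m), j⟩) = if j = i then 1 else 0 := by
  obtain ⟨ψ, hψ⟩ := LinearMap.exists_extend ((Module.finBasis F (M.primitive n p m)).coord i)
  refine ⟨ψ ∘ₗ (M.subTorsion n p m).mkQ, fun z hz => ?_, fun j => ?_⟩
  · rw [LinearMap.comp_apply, Submodule.mkQ_apply, (Submodule.Quotient.mk_eq_zero _).2 hz, map_zero]
  · rw [LinearMap.comp_apply, mkQ_gen ⟨(p, m), j⟩]
    refine (LinearMap.congr_fun hψ _).trans ?_
    simp [Finsupp.single_apply]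

/-- Modulo `subTorsion` the torsion becomes `primitive`, where the generators form a basis. -/
theorem torsion_le_span_gen (p : ℤ) (m : ℕ∞) : M.torsion n p m ≤
    Submodule.span F (Set.range fun i => M.gen n ⟨(p, m), i⟩) ⊔ M.subTorsion n p m := by
  intro z hz
  have hz' : (M.subTorsion n p m).mkQ z ∈ M.primitive n p m := Submodule.mem_map_of_mem hz
  have key := congrArg Subtype.val
    ((Module.finBasis F (M.primitive n p m)).sum_repr ⟨_, hz'⟩)
  set c := (Module.finBasis F (M.primitive n p m)).repr ⟨_, hz'⟩
  have : z - ∑ i, c i • M.gen n ⟨(p, m), i⟩ ∈ M.subTorsion n p m := by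
    rw [← Submodule.Quotient.mk_eq_zero, ← Submodule.mkQ_apply, map_sub, sub_eq_zero, map_sum]
    refine key.symm.trans ?_
    rw [AddSubmonoidClass.coe_finsetSum]
    exact Finset.sum_congr rfl fun i _ => by rw [map_smul, mkQ_gen ⟨(p, m), i⟩]; rfl
  rw [← add_sub_cancel (∑ i, c i • M.gen n ⟨(p, m), i⟩) z]
  exact Submodule.add_mem_sup (sum_mem fun i _ => Submodule.smul_mem _ _
    (Submodule.subset_span ⟨i, rfl⟩)) this

variable (M n) in
/-- The multiple `x ^ (p - s) g` of a generator `g` of degree `s`. -/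
noncomputable def genMul (a : M.GenIndex n) (p : ℤ) : M.X n p :=
  -- The value `0` below the birth degree makes `genMul` vanish wherever the bar is not alive.
  if h : a.1.1 ≤ p then M.xPow n (p - a.1.1).toNat (by omega) (M.gen n a) else 0

theorem genMul_self (a : M.GenIndex n) : M.genMul n a a.1.1 = M.gen n a := by
  have key : ∀ (k : ℕ) (h : a.1.1 + k = a.1.1), M.xPow n k h (M.gen n a) = M.gen n a := by
    intro k h
    obtain rfl : k = 0 := by omega
    rfl
  rw [genMul, dif_pos le_rfl, key]

theorem xPow_genMul (a : M.GenIndex n) {p q : ℤ} {k : ℕ} (h : p + k = q) (hp : a.1.1 ≤ p) :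
    M.xPow n k h (M.genMul n a p) = M.genMul n a q := by
  have key : ∀ (j : ℕ) (hj : a.1.1 + j = q), j = (p - a.1.1).toNat + k →
      M.xPow n j hj (M.gen n a) = M.xPow n k h (M.xPow n (p - a.1.1).toNat (by omega)
        (M.gen n a)) := by
    rintro _ hj rfl
    exact xPow_add _ _ _ _
  rw [genMul, genMul, dif_pos hp, dif_pos (by omega), key _ _ (by omega)]

theorem x_genMul (a : M.GenIndex n) {p q : ℤ} (h : p + 1 = q) (hp : a.1.1 ≤ p) :
    M.x n h (M.genMul n a p) = M.genMul n a q := by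
  rw [← xPow_genMul a (q := q) (k := 1) (by exact_mod_cast h) hp]
  exact (xPow_succ (p := p) (q := p) (k := 0) (by simp) h (by simpa using h) _).symm

theorem genMul_dead (a : M.GenIndex n) {p : ℤ} (hp : ¬ Alive a.1.1 a.1.2 p) :
    M.genMul n a p = 0 := by
  rw [genMul]
  split_ifs with h
  · exact gen_mem a _ _ _ (not_lt.1 fun h' => hp ⟨h, h'⟩)
  · rfl

/-- In a nontrivial relation, consider the lexicographically largest pair (birth `s`, order `m`).
The same combination formed in degree `s` is killed by `x ^ (p - s)`, a power below the `m`-th, so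
it lies in `subTorsion`, where a functional dual to the generators of type `(s, m)` must vanish. -/
theorem linearIndependent_genMul (p : ℤ) : LinearIndependent F
    fun a : {a : M.GenIndex n // Alive a.1.1 a.1.2 p} => M.genMul n a p := by
  classical
  rw [linearIndependent_iff']
  intro t c hsum a₀ ha₀
  by_contra hc₀
  let key : {a : M.GenIndex n // Alive a.1.1 a.1.2 p} → ℤ ×ₗ ℕ∞ := fun a => toLex a.1.1
  obtain ⟨a, hat, hmax⟩ := (t.filter fun a => c a ≠ 0).exists_max_image key
    ⟨a₀, Finset.mem_filter.2 ⟨ha₀, hc₀⟩⟩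
  obtain ⟨hat, hca⟩ := Finset.mem_filter.1 hat
  obtain ⟨⟨⟨s, m⟩, i⟩, hs, hm⟩ := a
  have hmax' : ∀ a ∈ t, c a ≠ 0 → a.1.1.1 < s ∨ a.1.1.1 = s ∧ a.1.1.2 ≤ m :=
    fun a ha hca => (Prod.Lex.le_iff.1 (hmax a (Finset.mem_filter.2 ⟨ha, hca⟩)))
  obtain ⟨φ, hφ, hφi⟩ := exists_functional i
  have hp : s + (p - s).toNat = p := by have := hs; dsimp at this; omega
  -- All generators with nonzero coefficient are born at or before `s`, so multiplication by `x ^ (p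
  -- - s)` turns this sum into the given relation.
  have hu : ∑ a ∈ t, c a • M.genMul n a.1 s ∈ M.torsion n s (p - s).toNat := by
    refine mem_torsion hp ?_
    rw [map_sum, ← hsum]
    refine Finset.sum_congr rfl fun a ha => ?_
    rw [map_smul]
    by_cases hca : c a = 0
    · rw [hca, zero_smul, zero_smul]
    · rw [xPow_genMul]
      rcases hmax' a ha hca with h | h
      · exact h.le
      · exact h.1.le
  have h0 := hφ _ (torsion_le_subTorsion s hm hu)
  rw [map_sum, Finset.sum_eq_single_of_mem _ hat, map_smul] at h0
  · have := (hφi i)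
    rw [← genMul_self, if_pos rfl] at this
    rw [this] at h0
    exact hca (by simpa using h0)
  · intro a ha hne
    rw [map_smul]
    by_cases hca : c a = 0
    · rw [hca, zero_smul]
    suffices φ (M.genMul n a.1 s) = 0 by rw [this, smul_zero]
    obtain ⟨⟨⟨s', m'⟩, j⟩, ha'⟩ := a
    -- The functional kills every other term: an earlier birth gives a multiple of `x`, a smaller
    -- order gives an element of `subTorsion`, and a different index of the same type is dual to
    -- zero.
    rcases hmax' _ ha hca with h | ⟨h, h'⟩
    · rw [← x_genMul _ (sub_add_cancel s 1) (by dsimp at h ⊢; omega)]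
      exact hφ _ (x_mem_subTorsion _ _ _)
    · dsimp at h h'
      subst h
      rw [genMul_self ⟨(s', m'), j⟩]
      rcases h'.lt_or_eq with h' | rfl
      · exact hφ _ (torsion_le_subTorsion _ h' (gen_mem ⟨(s', m'), j⟩))
      · rw [hφi, if_neg]
        rintro rfl
        exact hne rfl

/-- Induction on the degree, starting where the module vanishes: multiples of `x` are covered by the
previous degree, and the new elements are reached by induction on their torsion order. -/
theorem span_genMul {p₀ : ℤ} (h₀ : ∀ p ≤ p₀, Subsingleton (M.X n p)) (p : ℤ) :
    Submodule.span F (Set.range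
      fun a : {a : M.GenIndex n // Alive a.1.1 a.1.2 p} => M.genMul n a p) = ⊤ := by
  rcases le_total p p₀ with hp | hp
  · have := h₀ p hp
    exact Subsingleton.elim _ _
  induction p, hp using Int.leInduction with
  | base =>
    have := h₀ p₀ le_rfl
    exact Subsingleton.elim _ _
  | succ p hp ih =>
    set V := Submodule.span F (Set.range
      fun a : {a : M.GenIndex n // Alive a.1.1 a.1.2 (p + 1)} => M.genMul n a (p + 1)) with hV
    have hx : ∀ r (h : r + 1 = p + 1), LinearMap.range (M.x n h) ≤ V := by
      intro r h
      obtain rfl : r = p := by omega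
      rw [LinearMap.range_eq_map, ← ih, Submodule.map_span, Submodule.span_le]
      rintro _ ⟨_, ⟨⟨a, ha⟩, rfl⟩, rfl⟩
      rw [x_genMul a h ha.1]
      by_cases ha' : Alive a.1.1 a.1.2 (r + 1)
      · exact Submodule.subset_span ⟨⟨a, ha'⟩, rfl⟩
      · rw [genMul_dead a ha']
        exact zero_mem V
    -- The orders in `ℕ∞` are well ordered with `∞` last. Reaching `m = ∞` suffices, since `x ^
    -- ∞`-torsion is everything.
    have key : ∀ m, M.torsion n (p + 1) m ≤ V := by
      intro m
      induction m using WellFoundedLT.induction with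
      | ind m ihm =>
        rcases eq_or_ne m 0 with rfl | hm
        · rw [torsion_zero]
          exact bot_le
        refine (torsion_le_span_gen _ _).trans (sup_le ?_ (sup_le (hx _ _) (iSup₂_le ihm)))
        rw [Submodule.span_le]
        rintro _ ⟨i, rfl⟩
        exact Submodule.subset_span ⟨⟨⟨(p + 1, m), i⟩, Alive.birth (pos_iff_ne_zero.2 hm)⟩,
          genMul_self ⟨(p + 1, m), i⟩⟩
    exact eq_top_iff.2 ((torsion_top _).symm.le.trans (key ⊤))

/-- The interval basis given by homogeneous generators, for a module that is bounded below and
finite dimensional in each degree. -/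
noncomputable def genIntervalBasis (M : BigradedModule.{u, v} F)
    [∀ n p, FiniteDimensional F (M.X n p)] (p₀ : ℤ → ℤ)
    (h₀ : ∀ n, ∀ p ≤ p₀ n, Subsingleton (M.X n p)) :
    M.IntervalBasis (M.GenIndex ·) (fun _ a => a.1.1) (fun _ a => a.1.2) where
  basis n p := Module.Basis.mk (linearIndependent_genMul p) (span_genMul (h₀ n) p).ge
  x_alive n p q h a hp hq := by simpa using x_genMul a h hp.1
  x_dead n p q h a hp hq := by simpa [genMul_dead a hq] using x_genMul a h hp.1

end BigradedModule

/-! ### Homology of the elementary complexes -/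

namespace BigradedModule

variable {F : Type u} [Field F]

/-- `g` exhibits `M` as an interval module with one bar, in homological degree `n`, born in degree
`s` and of length `m`. -/
structure IsInterval (M : BigradedModule.{u, v} F) (n s : ℤ) (m : ℕ∞) (g : ∀ p, M.X n p) :
    Prop where
  ne_zero : ∀ p, Alive s m p → g p ≠ 0
  exists_smul : ∀ p, Alive s m p → ∀ z, ∃ c : F, c • g p = z
  x_apply : ∀ {p q : ℤ} (h : p + 1 = q), s ≤ p → M.x n h (g p) = g q
  subsingleton : ∀ n' p, ¬ (n = n' ∧ Alive s m p) → Subsingleton (M.X n' p)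

end BigradedModule

section FreeComponent

variable {F : Type u} [Field F]

theorem X_pow_mem_freeComponent {n s i p : ℤ} (hi : i = n) (h : s ≤ p) :
    (X ^ (p - s).toNat : F[X]) ∈ freeComponent F n s i p := by
  intro j hj
  rw [coeff_X_pow] at hj
  have : j = (p - s).toNat := by by_contra h'; simp [h'] at hj
  exact ⟨hi, by omega⟩

theorem exists_smul_X_pow_of_mem_freeComponent {n s i p : ℤ} {a : F[X]}
    (ha : a ∈ freeComponent F n s i p) : ∃ c : F, c • (X ^ (p - s).toNat : F[X]) = a := by
  refine ⟨a.coeff (p - s).toNat, ?_⟩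
  ext j
  rw [coeff_smul, coeff_X_pow]
  split_ifs with h
  · simp [h]
  · rw [smul_zero]
    by_contra hj
    have := (ha j (Ne.symm hj)).2
    omega

theorem freeComponent_eq_zero {n s i p : ℤ} (h : ¬ (i = n ∧ s ≤ p)) {a : F[X]}
    (ha : a ∈ freeComponent F n s i p) : a = 0 := by
  ext j
  by_contra hj
  have := ha j hj
  exact h ⟨this.1, by omega⟩

end FreeComponent

section Elementary

variable (F : Type u) [Field F]

/-- The class of `x ^ (p - s)`. -/
noncomputable def elementaryFreeGen (n s p : ℤ) : (elementaryFree F n s).homology.X n p :=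
  if h : s ≤ p then
    (elementaryFree F n s).homologyMk n p ⟨⟨_, X_pow_mem_freeComponent rfl h⟩, rfl⟩
  else 0

theorem isInterval_elementaryFree (n s : ℤ) :
    (elementaryFree F n s).homology.IsInterval n s ⊤ (elementaryFreeGen F n s) where
  ne_zero p hp h0 := by
    rw [elementaryFreeGen, dif_pos hp.1, GradedComplex.homologyMk_eq_zero] at h0
    obtain ⟨y, hy⟩ := h0
    exact pow_ne_zero _ X_ne_zero (congrArg Subtype.val hy).symm
  exists_smul p hp z := by
    obtain ⟨⟨⟨a, ha⟩, hz⟩, rfl⟩ := GradedComplex.homologyMk_surjective _ n p z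
    obtain ⟨c, rfl⟩ := exists_smul_X_pow_of_mem_freeComponent ha
    refine ⟨c, ?_⟩
    rw [elementaryFreeGen, dif_pos hp.1, ← map_smul]
    rfl
  x_apply {p q} h hp := by
    rw [elementaryFreeGen, elementaryFreeGen, dif_pos hp, dif_pos (by omega)]
    refine congrArg ((elementaryFree F n s).homologyMk n q) (Subtype.ext (Subtype.ext ?_))
    change (X ^ 1 * X ^ (p - s).toNat : F[X]) = X ^ (q - s).toNat
    rw [← pow_add]
    congr 1
    omega
  subsingleton n' p hp := by
    refine ⟨fun z z' => ?_⟩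
    have key : ∀ z : (elementaryFree F n s).homology.X n' p, z = 0 := by
      intro z
      obtain ⟨⟨⟨a, ha⟩, hz⟩, rfl⟩ := GradedComplex.homologyMk_surjective _ n' p z
      obtain rfl := freeComponent_eq_zero (fun h => hp ⟨h.1.symm, h.2, by simp⟩) ha
      exact map_zero _
    rw [key z, key z']

theorem elementaryTorsion_d (n s : ℤ) (m : ℕ) {i j : ℤ} (h : j + 1 = i) (p : ℤ)
    (z : (elementaryTorsion F n s m).X i p) :
    (((elementaryTorsion F n s m).d i j p z).1 : F[X]) = X ^ m * (z.2 : F[X]) ∧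
      ((elementaryTorsion F n s m).d i j p z).2 = 0 := by
  simp only [elementaryTorsion, dif_pos h]
  exact ⟨rfl, rfl⟩

/-- The class of `x ^ (p - s)`. -/
noncomputable def elementaryTorsionGen (n s : ℤ) (m : ℕ) (p : ℤ) :
    (elementaryTorsion F n s m).homology.X n p :=
  if h : s ≤ p then
    (elementaryTorsion F n s m).homologyMk n p ⟨(⟨_, X_pow_mem_freeComponent rfl h⟩, 0), by
      have hd := elementaryTorsion_d F n s m (sub_add_cancel n 1) p
        (⟨_, X_pow_mem_freeComponent rfl h⟩, 0)
      exact Prod.ext (Subtype.ext (hd.1.trans (mul_zero _))) hd.2⟩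
  else 0

/-- Multiplication by `x ^ m` is injective, so homology survives only in homological degree `n`, as
`F[x] / x ^ m` generated in degree `s`. -/
theorem isInterval_elementaryTorsion (n s : ℤ) (m : ℕ) :
    (elementaryTorsion F n s m).homology.IsInterval n s m (elementaryTorsionGen F n s m) where
  ne_zero p hp h0 := by
    rw [elementaryTorsionGen, dif_pos hp.1, GradedComplex.homologyMk_eq_zero] at h0
    obtain ⟨y, hy⟩ := h0
    have h1 := (elementaryTorsion_d F n s m rfl p y).1
    rw [hy] at h1
    -- A degree where the bar is alive lies below `s + m`, where the source generator begins, so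
    -- there are no boundaries.
    have hy2 : (y.2 : F[X]) = 0 := by
      refine freeComponent_eq_zero (fun h => ?_) y.2.2
      have := hp.2
      norm_cast at this
      omega
    rw [hy2, mul_zero] at h1
    exact pow_ne_zero _ X_ne_zero h1
  exists_smul p hp z := by
    obtain ⟨⟨⟨⟨a, ha⟩, b, hb⟩, hz⟩, rfl⟩ := GradedComplex.homologyMk_surjective _ n p z
    obtain ⟨c, rfl⟩ := exists_smul_X_pow_of_mem_freeComponent ha
    -- The second summand lives in homological degree `n + 1`, not `n`.
    obtain rfl := freeComponent_eq_zero (fun h => by omega) hb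
    refine ⟨c, ?_⟩
    rw [elementaryTorsionGen, dif_pos hp.1, ← map_smul]
    refine congrArg ((elementaryTorsion F n s m).homologyMk n p) (Subtype.ext (Prod.ext ?_ ?_))
    · rfl
    · exact smul_zero c
  x_apply {p q} h hp := by
    rw [elementaryTorsionGen, elementaryTorsionGen, dif_pos hp, dif_pos (by omega)]
    refine congrArg ((elementaryTorsion F n s m).homologyMk n q)
      (Subtype.ext (Prod.ext (Subtype.ext ?_) (Subtype.ext (mul_zero _))))
    change (X ^ 1 * X ^ (p - s).toNat : F[X]) = X ^ (q - s).toNat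
    rw [← pow_add]
    congr 1
    omega
  subsingleton n' p hp := by
    refine ⟨fun z z' => ?_⟩
    have key : ∀ z : (elementaryTorsion F n s m).homology.X n' p, z = 0 := by
      intro z
      obtain ⟨⟨⟨a, b⟩, hz⟩, rfl⟩ := GradedComplex.homologyMk_surjective _ n' p z
      have h1 := (elementaryTorsion_d F n s m (sub_add_cancel n' 1) p (a, b)).1
      rw [LinearMap.mem_ker.1 hz] at h1
      have hb : b = 0 := Subtype.ext <|
        (mul_eq_zero.1 h1.symm).resolve_left (pow_ne_zero _ X_ne_zero)
      subst hb
      rw [GradedComplex.homologyMk_eq_zero]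
      by_cases hn : n' = n ∧ s ≤ p
      · have hm : s + m ≤ p := by
          by_contra hm
          exact hp ⟨hn.1.symm, hn.2, by norm_cast; omega⟩
        obtain ⟨a, ha⟩ := a
        obtain ⟨c, rfl⟩ := exists_smul_X_pow_of_mem_freeComponent ha
        -- Past the death of the bar, `x ^ (p - s)` is `x ^ m` times the monomial `x ^ (p - (s +
        -- m))` of the source.
        refine ⟨(0, ⟨c • X ^ (p - (s + m)).toNat,
          Submodule.smul_mem _ c (X_pow_mem_freeComponent (by omega) hm)⟩), ?_⟩
        refine Prod.ext (Subtype.ext ?_) (elementaryTorsion_d F n s m rfl p _).2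
        refine (elementaryTorsion_d F n s m rfl p _).1.trans ?_
        change X ^ m * (c • X ^ (p - (s + m)).toNat : F[X]) = c • X ^ (p - s).toNat
        rw [mul_smul_comm, ← pow_add]
        congr 2
        omega
      · have ha : a = 0 := Subtype.ext (freeComponent_eq_zero hn a.2)
        subst ha
        exact ⟨0, map_zero _⟩
    rw [key z, key z']

theorem exists_isInterval_elementary (n s : ℤ) (m : ℕ∞) :
    ∃ g, (elementary F n s m).homology.IsInterval n s m g := by
  induction m using ENat.recTopCoe with
  | top => exact ⟨_, isInterval_elementaryFree F n s⟩
  | coe m => exact ⟨_, isInterval_elementaryTorsion F n s m⟩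

end Elementary

/-! ### Interval bases of direct sums of intervals -/

namespace BigradedModule

variable {F : Type u} [Field F]

namespace IsInterval

variable {M : BigradedModule.{u, v} F} {n s : ℤ} {m : ℕ∞} {g : ∀ p, M.X n p}

open Classical in
/-- The basis of a homogeneous component of an interval module. -/
noncomputable def basis (hg : M.IsInterval n s m g) (n' p : ℤ) :
    Module.Basis (PLift (n = n' ∧ Alive s m p)) F (M.X n' p) :=
  if h : n = n' ∧ Alive s m p then
    Module.Basis.mk (v := fun i => h.1 ▸ g p)
      (by
        obtain ⟨rfl, h⟩ := h
        have : Unique (PLift (n = n ∧ Alive s m p)) := ⟨⟨⟨⟨rfl, h⟩⟩⟩, fun _ => Subsingleton.elim _ _⟩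
        exact LinearIndependent.of_subsingleton ⟨⟨rfl, h⟩⟩ (hg.ne_zero p h))
      (by
        obtain ⟨rfl, h⟩ := h
        rintro z -
        obtain ⟨c, rfl⟩ := hg.exists_smul p h z
        exact Submodule.smul_mem _ _ (Submodule.subset_span ⟨⟨⟨rfl, h⟩⟩, rfl⟩))
  else
    have := hg.subsingleton n' p h
    have : IsEmpty (PLift (n = n' ∧ Alive s m p)) := ⟨fun i => h i.down⟩
    Module.Basis.empty _

theorem basis_apply (hg : M.IsInterval n s m g) (p : ℤ) (i : PLift (n = n ∧ Alive s m p)) :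
    hg.basis n p i = g p := by
  rw [basis, dif_pos i.down]
  simp

end IsInterval

theorem _root_.DFinsupp.basis_apply {ι R : Type*} {M : ι → Type*} [DecidableEq ι] [Semiring R]
    [∀ i, AddCommMonoid (M i)] [∀ i, Module R (M i)] {η : ι → Type*}
    (b : ∀ i, Module.Basis (η i) R (M i)) (a : Σ i, η i) :
    DFinsupp.basis b a = DFinsupp.single a.1 (b a.1 a.2) := by
  rw [Module.Basis.apply_eq_iff]
  refine (LinearEquiv.symm_apply_eq _).2 ?_
  refine Eq.trans ?_ (sigmaFinsuppEquivDFinsupp_single a 1).symm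
  change DFinsupp.mapRange (fun i x => (b i).repr x) (fun i => map_zero _)
    (DFinsupp.single a.1 (b a.1 a.2)) = _
  rw [DFinsupp.mapRange_single, Module.Basis.repr_self]

open Classical in
/-- A direct sum of interval modules has an interval basis. -/
noncomputable def directSumIntervalBasis {ι : ℤ → Type} {birth : ∀ n, ι n → ℤ}
    {len : ∀ n, ι n → ℕ∞} (M : (Σ n, ι n) → BigradedModule.{u, v} F)
    (g : ∀ a p, (M a).X a.1 p)
    (hg : ∀ a, (M a).IsInterval a.1 (birth a.1 a.2) (len a.1 a.2) (g a)) :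
    (directSum M).IntervalBasis ι birth len :=
  -- In a fixed bidegree each summand has at most one basis vector, and none unless it sits in
  -- homological degree `n` and is alive at `p`.
  let e : ∀ n p, (Σ a : Σ n, ι n, PLift (a.1 = n ∧ Alive (birth a.1 a.2) (len a.1 a.2) p)) ≃
      {a : ι n // Alive (birth n a) (len n a) p} := fun n p =>
    { toFun := fun ⟨⟨_, i⟩, ⟨⟨h, h'⟩⟩⟩ => ⟨h ▸ i, by subst h; exact h'⟩
      invFun := fun ⟨i, h⟩ => ⟨⟨n, i⟩, ⟨⟨rfl, h⟩⟩⟩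
      left_inv := by rintro ⟨⟨_, i⟩, ⟨⟨rfl, h'⟩⟩⟩; rfl
      right_inv := by rintro ⟨i, h⟩; rfl }
  let b : ∀ n p, Module.Basis {a : ι n // Alive (birth n a) (len n a) p} F
      ((directSum M).X n p) := fun n p =>
    (DFinsupp.basis fun a => (hg a).basis n p).reindex (e n p)
  have hb : ∀ n p (a : {a : ι n // Alive (birth n a) (len n a) p}),
      b n p a = DirectSum.lof F _ (fun a => (M a).X n p) ⟨n, a.1⟩ (g ⟨n, a.1⟩ p) := by
    rintro n p ⟨a, ha⟩
    have h := (DFinsupp.basis fun a => (hg a).basis n p).reindex_apply (e n p) ⟨a, ha⟩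
    rw [DFinsupp.basis_apply] at h
    refine h.trans ?_
    exact congrArg (DFinsupp.single _) ((hg ⟨n, a⟩).basis_apply p _)
  { basis := b
    x_alive := by
      intro n p q h a hp hq
      rw [hb, hb, ← (hg ⟨n, a⟩).x_apply h hp.1]
      exact DirectSum.lmap_lof _ _ _
    x_dead := by
      intro n p q h a hp hq
      have := (hg ⟨n, a⟩).subsingleton n q (fun h => hq h.2)
      rw [hb]
      refine (DirectSum.lmap_lof _ _ _).trans ?_
      rw [Subsingleton.elim ((M ⟨n, a⟩).x n h (g ⟨n, a⟩ p)) 0]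
      exact map_zero _ }

end BigradedModule

/-! ### Ordered enumeration of the bars and existence of decompositions -/

/-- A type whose elements are ordered by an injective key, each of them with finitely many
predecessors, is enumerated in increasing order by an initial segment of the positive integers. -/
theorem exists_monotone_enumeration {B α : Type*} [LinearOrder α] (key : B → α)
    (hkey : Function.Injective key) (hfin : ∀ b, {b' | key b' < key b}.Finite) :
    ∃ (K : ℕ∞) (e : {i : ℕ // 1 ≤ i ∧ (i : ℕ∞) ≤ K} ≃ B),
      ∀ i j, i.1 < j.1 → key (e i) < key (e j) := by
  classical
  let rank : B → ℕ := fun b => {b' | key b' < key b}.ncard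
  have hmono : ∀ b b', key b < key b' → rank b < rank b' := fun b b' h =>
    Set.ncard_lt_ncard ⟨fun c hc => lt_trans hc h, fun h' => lt_irrefl _ (h' h)⟩ (hfin b')
  have hinj : Function.Injective rank := by
    intro b b' h
    by_contra hne
    rcases lt_or_gt_of_ne (hkey.ne hne) with h' | h'
    · exact (hmono _ _ h').ne h
    · exact (hmono _ _ h').ne' h
  have hdown : ∀ b j, j < rank b → ∃ b', rank b' = j := by
    intro b j hj
    -- `rank` embeds the `rank b` predecessors of `b` into the numbers below `rank b`; equal
    -- cardinalities force equality, so the ranks have no gaps.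
    have himage : rank '' {b' | key b' < key b} = Set.Iio (rank b) := by
      refine Set.eq_of_subset_of_ncard_le ?_ ?_
      · rintro _ ⟨b', hb', rfl⟩
        exact hmono _ _ hb'
      · rw [Set.ncard_image_of_injective _ hinj, Set.ncard_eq_toFinset_card']
        simp [rank]
    obtain ⟨b', -, hb'⟩ := himage.symm.subset (Set.mem_Iio.2 hj)
    exact ⟨b', hb'⟩
  -- `K` is the least number that is not a rank, or `∞` if every number is one. Positions start at
  -- `1`, ranks at `0`.
  obtain ⟨K, hK⟩ : ∃ K : ℕ∞, ∀ i : ℕ, ((i + 1 : ℕ) : ℕ∞) ≤ K ↔ ∃ b, rank b = i := by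
    by_cases h : ∃ N, ∀ b, rank b ≠ N
    · refine ⟨(Nat.find h : ℕ), fun i => ?_⟩
      rw [Nat.cast_le, Nat.succ_le_iff, Nat.lt_find_iff]
      refine ⟨fun hi => by simpa using hi i le_rfl, ?_⟩
      rintro ⟨b, rfl⟩ j hj hb
      rcases hj.lt_or_eq with hj | rfl
      · obtain ⟨b', hb'⟩ := hdown b j hj
        exact hb b' hb'
      · exact hb b rfl
    · push Not at h
      exact ⟨⊤, fun i => by simpa using h i⟩
  have hK' : ∀ b, 1 ≤ rank b + 1 ∧ ((rank b + 1 : ℕ) : ℕ∞) ≤ K :=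
    fun b => ⟨by omega, (hK _).2 ⟨b, rfl⟩⟩
  let f : B → {i : ℕ // 1 ≤ i ∧ (i : ℕ∞) ≤ K} := fun b => ⟨rank b + 1, hK' b⟩
  have hf : Function.Bijective f := by
    refine ⟨fun b b' h => hinj (by simpa [f] using h), ?_⟩
    rintro ⟨i, hi, hiK⟩
    obtain ⟨i, rfl⟩ := Nat.exists_eq_add_of_le' hi
    obtain ⟨b, rfl⟩ := (hK i).1 hiK
    exact ⟨b, rfl⟩
  refine ⟨K, (Equiv.ofBijective f hf).symm, fun i j hij => ?_⟩
  obtain ⟨b, rfl⟩ := hf.2 i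
  obtain ⟨b', rfl⟩ := hf.2 j
  rw [Equiv.ofBijective_symm_apply_apply, Equiv.ofBijective_symm_apply_apply]
  by_contra h
  rcases (not_lt.1 h).lt_or_eq with h | h
  · have := hmono _ _ h
    simp only [f] at hij
    omega
  · rw [hkey h] at hij
    exact lt_irrefl _ hij

namespace ElementarySequence

variable {F : Type u} [Field F] {M : BigradedModule.{u, v} F}

/-- The terms of the sequence in homological degree `n`. -/
abbrev Term (S : ElementarySequence) (n : ℤ) : Type := {i : ℕ // 1 ≤ i ∧ (i : ℕ∞) ≤ S.K n}

variable (M) in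
/-- Interval bases with bars given by an elementary sequence. -/
abbrev Bases (S : ElementarySequence) : Type _ :=
  M.IntervalBasis S.Term (fun n i => S.s n i) (fun n i => S.m n i)

/-- The direct sum carries an interval basis with the bars of `S`. Isomorphisms transport such
bases, and matching two of them bar by bar gives an isomorphism. -/
theorem decomposes_iff (S : ElementarySequence) :
    S.Decomposes M ↔ Nonempty (S.Bases M) := by
  choose g hg using fun a : S.Index => exists_isInterval_elementary F a.1 (S.s a.1 a.2)
    (S.m a.1 a.2)
  let c := BigradedModule.directSumIntervalBasis (ι := S.Term) (birth := fun n i => S.s n i)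
    (len := fun n i => S.m n i) _ g hg
  exact ⟨fun ⟨e⟩ => ⟨.ofIso e c⟩, fun ⟨b⟩ => ⟨b.iso c⟩⟩

/-- A bounded below and locally finite bigraded module is a direct sum of intervals. -/
theorem exists_decomposes [∀ n p, FiniteDimensional F (M.X n p)] (p₀ : ℤ → ℤ)
    (h₀ : ∀ n, ∀ p ≤ p₀ n, Subsingleton (M.X n p)) :
    ∃ S : ElementarySequence, S.Decomposes M := by
  let b := M.genIntervalBasis p₀ h₀
  -- Bars born at `c` are alive at `c`, where the component is finite dimensional.
  have hfin : ∀ n c, {a : M.GenIndex n | a.1.1 = c}.Finite := by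
    intro n c
    refine (b.finite_alive (n := n) c).subset ?_
    rintro a rfl
    exact .birth a.len_pos
  have hlow : ∀ n (a : M.GenIndex n), p₀ n < a.1.1 := by
    intro n a
    by_contra h
    have := h₀ n _ (not_lt.1 h)
    exact (b.basis n a.1.1).ne_zero ⟨a, .birth a.len_pos⟩ (Subsingleton.elim _ _)
  -- Birth, then length; the basis number only breaks ties.
  let key : ∀ n, M.GenIndex n → ℤ ×ₗ ℕ∞ ×ₗ ℕ := fun n a => toLex (a.1.1, toLex (a.1.2, a.2))
  have hkey : ∀ n, Function.Injective (key n) := by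
    rintro n ⟨⟨s, m⟩, i⟩ ⟨⟨s', m'⟩, i'⟩ h
    obtain ⟨h1, h2⟩ := Prod.mk.inj (toLex.injective h)
    obtain ⟨h2', h3⟩ := Prod.mk.inj (toLex.injective h2)
    clear h2
    dsimp at h1 h2' h3
    subst h1 h2'
    rw [Fin.ext h3]
  have hkey_fin : ∀ n a, {a' | key n a' < key n a}.Finite := by
    intro n a
    refine ((Set.finite_Icc (p₀ n) a.1.1).biUnion fun c _ => hfin n c).subset fun a' ha' => ?_
    refine Set.mem_biUnion (x := a'.1.1) ⟨(hlow n a').le, ?_⟩ rfl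
    rcases Prod.Lex.lt_iff.1 ha' with h | h
    · exact h.le
    · exact h.1.le
  choose K e he using fun n => exists_monotone_enumeration (key n) (hkey n) (hkey_fin n)
  have hle : ∀ n i (hi : 1 ≤ i) (hi' : ((i + 1 : ℕ) : ℕ∞) ≤ K n) (h : 1 ≤ i ∧ (i : ℕ∞) ≤ K n),
      key n (e n ⟨i, h⟩) < key n (e n ⟨i + 1, by omega, hi'⟩) :=
    fun n i _ _ _ => he n _ _ (Nat.lt_succ_self i)
  have hK : ∀ n (i : ℕ), ((i + 1 : ℕ) : ℕ∞) ≤ K n → (i : ℕ∞) ≤ K n :=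
    fun n i h => le_trans (by exact_mod_cast Nat.le_succ i) h
  let S : ElementarySequence :=
    { K := K
      s := fun n i => if h : 1 ≤ i ∧ (i : ℕ∞) ≤ K n then (e n ⟨i, h⟩).1.1 else 0
      m := fun n i => if h : 1 ≤ i ∧ (i : ℕ∞) ≤ K n then (e n ⟨i, h⟩).1.2 else 0
      m_pos := by
        intro n i hi hi'
        rw [dif_pos ⟨hi, hi'⟩]
        exact (e n ⟨i, hi, hi'⟩).len_pos
      finite := by
        intro n c
        refine ((hfin n c).image fun a => ((e n).symm a).1).subset ?_
        rintro i ⟨hi, hi', h⟩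
        rw [dif_pos ⟨hi, hi'⟩] at h
        exact ⟨e n ⟨i, hi, hi'⟩, h, by simp⟩
      s_le := by
        intro n i hi hi'
        rw [dif_pos ⟨hi, hK n i hi'⟩, dif_pos ⟨by omega, hi'⟩]
        rcases Prod.Lex.lt_iff.1 (hle n i hi hi' ⟨hi, hK n i hi'⟩) with h | h
        · exact h.le
        · exact h.1.le
      m_le := by
        intro n i hi hi' hs
        rw [dif_pos ⟨hi, hK n i hi'⟩, dif_pos ⟨by omega, hi'⟩] at hs ⊢
        rcases Prod.Lex.lt_iff.1 (hle n i hi hi' ⟨hi, hK n i hi'⟩) with h | h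
        · exact absurd hs h.ne
        · rcases Prod.Lex.lt_iff.1 h.2 with h | h
          · exact h.le
          · exact h.1.le }
  refine ⟨S, S.decomposes_iff.2 ⟨?_⟩⟩
  have hs : (fun n (i : S.Term n) => S.s n i) = fun n i => (e n i).1.1 := by
    funext n i
    exact dif_pos i.2
  have hm : (fun n (i : S.Term n) => S.m n i) = fun n i => (e n i).1.2 := by
    funext n i
    exact dif_pos i.2
  rw [Bases, hs, hm]
  exact b.reindex e

end ElementarySequence

/-! ### Dimensions of the pages through ranks of powers of `x` -/

namespace ExactCouple

variable {F : Type u} [Field F] (X : ExactCouple.{u, v} F)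

/-- `E` is an extension of the image of `h`, inside `A`, by the image of `g`, a quotient of `A`. -/
theorem finiteDimensional_E [∀ n p, FiniteDimensional F (X.A n p)] (n s : ℤ) :
    FiniteDimensional F (X.E n s) := by
  have h := X.exact_g_h (n := n) (p := s + X.k) rfl (sub_add_cancel n 1) (sub_add_cancel s 1)
  have : FiniteDimensional F (LinearMap.ker
      (X.h (sub_add_cancel n 1) (sub_add_cancel s 1) : X.E n s →ₗ[F] _)) := by
    rw [h.linearMap_ker_eq]
    infer_instance
  have := Module.Finite.equiv
    (X.h (sub_add_cancel n 1) (sub_add_cancel s 1) : X.E n s →ₗ[F] _).quotKerEquivRange.symm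
  exact Module.Finite.of_submodule_quotient
    (LinearMap.ker (X.h (sub_add_cancel n 1) (sub_add_cancel s 1) : X.E n s →ₗ[F] _))

/-- The dimension of the `E`-term of an exact couple. -/
theorem finrank_E [∀ n p, FiniteDimensional F (X.A n p)] {n n' s p q r : ℤ} (hn : n' + 1 = n)
    (hp : p + 1 = q) (hq : s + X.k = q) (hr : r + 1 = s) :
    Module.finrank F (X.E n s) + Module.finrank F (LinearMap.range (X.f n hp)) +
      Module.finrank F (LinearMap.range (X.f n' hr)) =
      Module.finrank F (X.A n q) + Module.finrank F (X.A n' r) := by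
  have := X.finiteDimensional_E n s
  -- Rank-nullity for `g`, `h` and `f`, with each kernel replaced by the preceding range.
  have h1 := (X.g n hq).finrank_range_add_finrank_ker
  have h2 := (X.h hn hr).finrank_range_add_finrank_ker
  have h3 := (X.f n' hr).finrank_range_add_finrank_ker
  rw [(X.exact_f_g n hp hq).linearMap_ker_eq] at h1
  rw [(X.exact_g_h hq hn hr).linearMap_ker_eq] at h2
  rw [(X.exact_h_f hn hr hr).linearMap_ker_eq] at h3
  omega

end ExactCouple

namespace GradedComplex

variable {F : Type u} [Field F] (K : GradedComplex.{u, v} F)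

/-- The `A`-term of the `r`-fold derived exact couple is `x ^ r H(K)`. -/
theorem exists_iterate_derive_embedding (r : ℕ) :
    (ExactCouple.derive^[r] K.exactCouple).k = r ∧
    ∃ j : ∀ n p, (ExactCouple.derive^[r] K.exactCouple).A n p →ₗ[F] K.homology.X n p,
      (∀ n p, Function.Injective (j n p)) ∧
      (∀ (n : ℤ) {p q : ℤ} (h : p + 1 = q) z,
        j n q ((ExactCouple.derive^[r] K.exactCouple).f n h z) = K.homology.x n h (j n p z)) ∧
      ∀ (n : ℤ) {p q : ℤ} (h : p + r = q),
        LinearMap.range (j n q) = LinearMap.range (K.homology.xPow n r h) := by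
  induction r with
  | zero =>
    refine ⟨rfl, fun n p => LinearMap.id, fun n p => Function.injective_id, fun n p q h z => rfl,
      fun n p q h => ?_⟩
    obtain rfl : p = q := by simpa using h
    rfl
  | succ r ih =>
    rw [Function.iterate_succ_apply']
    set X := ExactCouple.derive^[r] K.exactCouple
    obtain ⟨hk, j, hj, hjx, hjr⟩ := ih
    refine ⟨by change X.k + 1 = _; rw [hk]; push_cast; rfl,
      fun n p => j n p ∘ₗ Submodule.subtype _,
      fun n p => (hj n p).comp (Submodule.subtype_injective _), fun n p q h z => hjx n h _,
      fun n p q h => ?_⟩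
    have hpq : p + r = q - 1 := by omega
    ext z
    constructor
    · rintro ⟨⟨_, a, rfl⟩, rfl⟩
      obtain ⟨y, hy⟩ := (hjr n hpq).le ⟨a, rfl⟩
      refine ⟨y, ?_⟩
      rw [BigradedModule.xPow_succ hpq (sub_add_cancel q 1), hy]
      exact (hjx n _ a).symm
    · rintro ⟨y, rfl⟩
      obtain ⟨a, ha⟩ := (hjr n hpq).ge ⟨y, rfl⟩
      refine ⟨⟨_, a, rfl⟩, ?_⟩
      rw [BigradedModule.xPow_succ hpq (sub_add_cancel q 1), ← ha]
      exact hjx n _ a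

/-- The dimension of the `(r + 1)`-st page in terms of the ranks of powers of `x` on homology. -/
theorem finrank_page [∀ n p, FiniteDimensional F (K.homology.X n p)] (r : ℕ) {n n' s a b c d : ℤ}
    (hn : n' + 1 = n) (ha : s + r = a) (hb : b + (r + 1 : ℕ) = a) (hc : c + r = d)
    (hd : c + (r + 1 : ℕ) = s) :
    FiniteDimensional F (K.page (r + 1) n s) ∧
    Module.finrank F (K.page (r + 1) n s) +
      Module.finrank F (LinearMap.range (K.homology.xPow n (r + 1) hb)) +
      Module.finrank F (LinearMap.range (K.homology.xPow n' (r + 1) hd)) =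
      Module.finrank F (LinearMap.range (K.homology.xPow n r ha)) +
      Module.finrank F (LinearMap.range (K.homology.xPow n' r hc)) := by
  change FiniteDimensional F ((ExactCouple.derive^[r] K.exactCouple).E n s) ∧
    Module.finrank F ((ExactCouple.derive^[r] K.exactCouple).E n s) + _ + _ = _
  have hderive := K.exists_iterate_derive_embedding r
  generalize ExactCouple.derive^[r] K.exactCouple = X at hderive ⊢
  obtain ⟨hk, j, hj, hjx, hjr⟩ := hderive
  have hA : ∀ n p, FiniteDimensional F (X.A n p) :=
    fun n p => Module.Finite.of_injective (j n p) (hj n p)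
  -- `f` is multiplication by `x` on `x ^ r H`, so its range is `x ^ (r + 1) H`.
  have hf : ∀ (n : ℤ) {p q t : ℤ} (h : p + 1 = q) (ht : t + (r + 1 : ℕ) = q),
      Module.finrank F (LinearMap.range (X.f n h)) =
        Module.finrank F (LinearMap.range (K.homology.xPow n (r + 1) ht)) := by
    intro n p q t h ht
    have htp : t + r = p := by omega
    have h1 : j n q ∘ₗ X.f n h = K.homology.x n h ∘ₗ j n p := LinearMap.ext (hjx n h)
    have h2 : K.homology.xPow n (r + 1) ht = K.homology.x n h ∘ₗ K.homology.xPow n r htp :=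
      LinearMap.ext (BigradedModule.xPow_succ htp h ht)
    rw [((LinearMap.range (X.f n h)).equivMapOfInjective (j n q) (hj n q)).finrank_eq,
      ← LinearMap.range_comp, h1, h2, LinearMap.range_comp, LinearMap.range_comp, hjr n htp]
  have hdim : ∀ (n : ℤ) {p q : ℤ} (h : p + r = q), Module.finrank F (X.A n q) =
      Module.finrank F (LinearMap.range (K.homology.xPow n r h)) := by
    intro n p q h
    rw [← hjr n h, LinearMap.finrank_range_of_inj (hj n q)]
  refine ⟨X.finiteDimensional_E n s, ?_⟩
  rw [← hf n (sub_add_cancel a 1) hb, ← hf n' (p := d) (by omega) hd, ← hdim n ha, ← hdim n' hc]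
  exact X.finrank_E hn _ (by rw [hk, ha]) _

end GradedComplex

/-! ### Counting bars by multiplicities -/

/-- A finite set is partitioned by the values of a function. -/
theorem Set.Finite.ncard_eq_finsum_fiber {α : Type*} {T : Set α} (hT : T.Finite) (len : α → ℕ∞)
    (r : ℕ) (hr : ∀ a ∈ T, (r : ℕ∞) ≤ len a ∧ len a ≠ ⊤) :
    {m : ℕ | r ≤ m ∧ {a ∈ T | len a = m}.ncard ≠ 0}.Finite ∧
    T.ncard = ∑ᶠ (m : ℕ) (_ : r ≤ m), {a ∈ T | len a = m}.ncard := by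
  classical
  have hlen : ∀ a ∈ T, ∀ m : ℕ, len a = m ↔ (len a).toNat = m := by
    intro a ha m
    obtain ⟨k, hk⟩ := ENat.ne_top_iff_exists.1 (hr a ha).2
    rw [← hk, ENat.toNat_natCast, Nat.cast_inj]
  -- A nonempty fiber already forces `r ≤ m`, so that restriction can be dropped from the sum.
  have hsub : ∀ m : ℕ, {a ∈ T | len a = m}.ncard ≠ 0 →
      r ≤ m ∧ m ∈ hT.toFinset.image fun a => (len a).toNat := by
    intro m hm
    obtain ⟨a, ha, ham⟩ := Set.nonempty_of_ncard_ne_zero hm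
    refine ⟨?_, Finset.mem_image.2 ⟨a, hT.mem_toFinset.2 ha, (hlen a ha m).1 ham⟩⟩
    have := (hr a ha).1
    rw [ham] at this
    exact_mod_cast this
  refine ⟨(Finset.finite_toSet _).subset fun m hm => (hsub m hm.2).2, ?_⟩
  have h1 : ∀ m : ℕ, (∑ᶠ (_ : r ≤ m), {a ∈ T | len a = m}.ncard) =
      {a ∈ T | len a = m}.ncard := by
    intro m
    rw [finsum_eq_if]
    split_ifs with h
    · rfl
    · by_contra h'
      exact h (hsub m (Ne.symm h')).1
  rw [finsum_congr h1, finsum_eq_sum_of_support_subset _ fun m hm => (hsub m hm).2,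
    Set.ncard_eq_toFinset_card T hT,
    Finset.card_eq_sum_card_image (fun a => (len a).toNat) hT.toFinset]
  refine Finset.sum_congr rfl fun m _ => ?_
  rw [← Set.ncard_coe_finset]
  congr 1
  ext a
  simp only [Finset.coe_filter, Set.Finite.mem_toFinset, Set.mem_ofPred_eq]
  exact and_congr_right fun ha => (hlen a ha m).symm

namespace ElementarySequence

variable {F : Type u} [Field F] (S : ElementarySequence)

theorem multiplicity_eq (n s : ℤ) (m : ℕ∞) :
    S.multiplicity n s m = {a : S.Term n | S.s n a = s ∧ S.m n a = m}.ncard := by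
  rw [multiplicity, ← Set.ncard_image_of_injective _ Subtype.val_injective]
  congr 1
  ext i
  constructor
  · rintro ⟨h1, h2, h3, h4⟩
    exact ⟨⟨i, h1, h2⟩, ⟨h3, h4⟩, rfl⟩
  · rintro ⟨⟨i, h1, h2⟩, ⟨h3, h4⟩, rfl⟩
    exact ⟨h1, h2, h3, h4⟩

theorem finite_birth_eq (n s : ℤ) : {a : S.Term n | S.s n a = s}.Finite := by
  refine Set.Finite.of_finite_image ((S.finite n s).subset ?_) Subtype.val_injective.injOn
  rintro _ ⟨⟨i, h1, h2⟩, h, rfl⟩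
  exact ⟨h1, h2, h⟩

/-- The number of bars of length at least `r` born in degree `s`. -/
theorem ncard_birth (r : ℕ) (n s : ℤ) :
    {m : ℕ | r ≤ m ∧ S.multiplicity n s m ≠ 0}.Finite ∧
    {a : S.Term n | S.s n a = s ∧ (r : ℕ∞) ≤ S.m n a}.ncard = S.multiplicity n s ⊤ +
      ∑ᶠ (m : ℕ) (_ : r ≤ m), S.multiplicity n s m := by
  -- The bars of finite length; the infinite ones are the term `S.multiplicity n s ⊤`.
  set T : Set (S.Term n) := {a | S.s n a = s ∧ (r : ℕ∞) ≤ S.m n a ∧ S.m n a ≠ ⊤}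
  have hT : T.Finite := (S.finite_birth_eq n s).subset fun a ha => ha.1
  have hm : ∀ m : ℕ, r ≤ m → {a ∈ T | S.m n a = m}.ncard = S.multiplicity n s m := by
    intro m hm
    rw [multiplicity_eq]
    congr 1
    ext a
    refine ⟨fun h => ⟨h.1.1, h.2⟩, fun h => ⟨⟨h.1, ?_, ?_⟩, h.2⟩⟩
    · rw [h.2]; exact_mod_cast hm
    · rw [h.2]; exact ENat.natCast_ne_top m
  obtain ⟨h1, h2⟩ := hT.ncard_eq_finsum_fiber (fun a => S.m n a) r fun a ha => ha.2
  refine ⟨h1.subset fun m h => ⟨h.1, by rw [hm m h.1]; exact h.2⟩, ?_⟩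
  rw [← finsum_congr fun m => finsum_congr (hm m), ← h2, multiplicity_eq,
    ← Set.ncard_union_eq ?_ ((S.finite_birth_eq n s).subset fun a ha => ha.1) hT]
  · congr 1
    ext a
    by_cases h : S.m n a = ⊤ <;> simp [T, h]
  · rw [Set.disjoint_left]
    exact fun a ha ha' => ha'.2.2 ha.2

/-- The number of bars of length at least `r` that die in degree `s`. -/
theorem ncard_death (r : ℕ) (n s : ℤ)
    (hT : {a : S.Term n | ∃ m : ℕ, r ≤ m ∧ S.m n a = m ∧ S.s n a = s - m}.Finite) :
    {m : ℕ | r ≤ m ∧ S.multiplicity n (s - m) m ≠ 0}.Finite ∧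
    {a : S.Term n | ∃ m : ℕ, r ≤ m ∧ S.m n a = m ∧ S.s n a = s - m}.ncard =
      ∑ᶠ (m : ℕ) (_ : r ≤ m), S.multiplicity n (s - m) m := by
  set T : Set (S.Term n) := {a | ∃ m : ℕ, r ≤ m ∧ S.m n a = m ∧ S.s n a = s - m}
  have hm : ∀ m : ℕ, r ≤ m → {a ∈ T | S.m n a = m}.ncard = S.multiplicity n (s - m) m := by
    intro m hm
    rw [multiplicity_eq]
    congr 1
    ext a
    refine ⟨?_, fun h => ⟨⟨m, hm, h.2, h.1⟩, h.2⟩⟩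
    rintro ⟨⟨m', h1, h2, h3⟩, h4⟩
    obtain rfl : m' = m := by exact_mod_cast h2.symm.trans h4
    exact ⟨h3, h4⟩
  obtain ⟨h1, h2⟩ := hT.ncard_eq_finsum_fiber (fun a => S.m n a) r (by
    rintro a ⟨m, h1, h2, -⟩
    rw [h2]
    exact ⟨by exact_mod_cast h1, ENat.natCast_ne_top m⟩)
  refine ⟨h1.subset fun m h => ⟨h.1, by rw [hm m h.1]; exact h.2⟩, ?_⟩
  rw [← finsum_congr fun m => finsum_congr (hm m), ← h2]

/-- The dimension of the pages of a graded complex with decomposed homology. -/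
theorem finrank_page_eq_ncard (K : GradedComplex.{u, v} F)
    [∀ n p, FiniteDimensional F (K.homology.X n p)] (b : S.Bases K.homology) (r : ℕ) (n s : ℤ) :
    {a : S.Term (n - 1) | ∃ m : ℕ, r + 1 ≤ m ∧ S.m (n - 1) a = m ∧ S.s (n - 1) a = s - m}.Finite ∧
    Module.finrank F (K.page (r + 1) n s) =
      {a : S.Term n | S.s n a = s ∧ ((r + 1 : ℕ) : ℕ∞) ≤ S.m n a}.ncard +
      {a : S.Term (n - 1) |
        ∃ m : ℕ, r + 1 ≤ m ∧ S.m (n - 1) a = m ∧ S.s (n - 1) a = s - m}.ncard := by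
  have h := (K.finrank_page r (n := n) (s := s) (b := s - 1) (c := s - 1 - r) (d := s - 1)
    (sub_add_cancel n 1) rfl (by push_cast; ring) (by ring) (by push_cast; ring)).2
  simp only [b.finrank_range_xPow] at h
  set B : Set (S.Term n) := {a | Alive (S.s n a) (S.m n a) (s - 1) ∧
    Alive (S.s n a) (S.m n a) (s + r)}
  set D : Set (S.Term (n - 1)) := {a | Alive (S.s (n - 1) a) (S.m (n - 1) a) (s - 1 - r) ∧
    Alive (S.s (n - 1) a) (S.m (n - 1) a) s}
  set T : Set (S.Term n) := {a | S.s n a = s ∧ ((r + 1 : ℕ) : ℕ∞) ≤ S.m n a}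
  set T' : Set (S.Term (n - 1)) :=
    {a | ∃ m : ℕ, r + 1 ≤ m ∧ S.m (n - 1) a = m ∧ S.s (n - 1) a = s - m}
  -- Bars alive at `s` and `s + r` are either born at `s`, with length greater than `r`, or already
  -- alive at `s - 1`; the latter are subtracted by the rank of `x ^ (r + 1)`.
  have hT : {a : S.Term n | Alive (S.s n a) (S.m n a) s ∧ Alive (S.s n a) (S.m n a) (s + r)} = T ∪ B := by
    ext a
    constructor
    · rintro ⟨h1, h2⟩
      rcases h1.1.lt_or_eq with h3 | h3
      · exact Or.inr ⟨h2.of_le (by omega) (by omega), h2⟩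
      · refine Or.inl ⟨h3, ?_⟩
        have := h2.2
        rw [h3, add_sub_cancel_left, Int.toNat_natCast] at this
        exact_mod_cast Order.add_one_le_of_lt this
    · rintro (⟨h1, h2⟩ | ⟨h1, h2⟩)
      · subst h1
        have : Alive (S.s n a) (S.m n a) (S.s n a + r) := by
          refine ⟨by omega, ?_⟩
          rw [add_sub_cancel_left, Int.toNat_natCast]
          exact lt_of_lt_of_le (by exact_mod_cast Nat.lt_succ_self r) h2
        exact ⟨this.of_le le_rfl (by omega), this⟩
      · exact ⟨h2.of_le (h1.1.trans (by omega)) (by omega), h2⟩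
  -- Bars alive at `s - 1 - r` and `s - 1` either survive to `s` or die exactly there, with length
  -- at least `r + 1`.
  have hT' : {a : S.Term (n - 1) | Alive (S.s (n - 1) a) (S.m (n - 1) a) (s - 1 - r) ∧
      Alive (S.s (n - 1) a) (S.m (n - 1) a) (s - 1)} = T' ∪ D := by
    ext a
    constructor
    · rintro ⟨h1, h2⟩
      by_cases h3 : Alive (S.s (n - 1) a) (S.m (n - 1) a) s
      · exact Or.inr ⟨h1, h3⟩
      · have h4 : S.m (n - 1) a ≤ (s - S.s (n - 1) a).toNat :=
          not_lt.1 fun h4 => h3 ⟨h2.1.trans (by omega), h4⟩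
        obtain ⟨m, hm⟩ := ENat.ne_top_iff_exists.1 (ne_top_of_le_ne_top (ENat.natCast_ne_top _) h4)
        have h5 := h2.2
        have h6 := h1.1
        rw [← hm] at h4 h5
        norm_cast at h4 h5
        exact Or.inl ⟨m, by omega, hm.symm, by omega⟩
    · rintro (⟨m, h1, h2, h3⟩ | ⟨h1, h2⟩)
      · have : Alive (S.s (n - 1) a) (S.m (n - 1) a) (s - 1) := by
          rw [h2, h3]
          exact ⟨by omega, by norm_cast; omega⟩
        exact ⟨this.of_le (by omega) (by omega), this⟩
      · exact ⟨h1, h2.of_le (h1.1.trans (by omega)) (by omega)⟩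
  have hfin : (T ∪ B).Finite := hT ▸ (b.finite_alive s).subset fun a h => h.1
  -- Finiteness of the set of deaths at `s` is not built into `ElementarySequence`; it holds because
  -- such bars are alive at `s - 1`, where homology is finite dimensional.
  have hfin' : (T' ∪ D).Finite := hT' ▸ (b.finite_alive (s - 1)).subset fun a h => h.2
  have hdisj : Disjoint T B := Set.disjoint_left.2 fun a h h' => by
    have h1 := h.1
    have h2 := h'.1.1
    omega
  have hdisj' : Disjoint T' D := by
    refine Set.disjoint_left.2 ?_
    rintro a ⟨m, h1, h2, h3⟩ h'
    have h4 := h'.2.2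
    rw [h2, h3] at h4
    norm_cast at h4
    omega
  rw [hT, hT', Set.ncard_union_eq hdisj (hfin.subset Set.subset_union_left)
    (hfin.subset Set.subset_union_right), Set.ncard_union_eq hdisj'
    (hfin'.subset Set.subset_union_left) (hfin'.subset Set.subset_union_right)] at h
  exact ⟨hfin'.subset Set.subset_union_left, by omega⟩

end ElementarySequence

/-! ### The main theorem -/

theorem proposition4p2 {F : Type u} [Field F] (C : FilteredComplex.{u, v} F)
    (hbdd : C.BoundedBelow) (hfin : C.LocallyFinite) :
    (∃ S : ElementarySequence, S.Decomposes C.persistentHomology) ∧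
    ∀ S : ElementarySequence, S.Decomposes C.persistentHomology →
      ∀ r : ℕ, 0 < r → ∀ n s : ℤ,
        FiniteDimensional F (C.page r n s) ∧
        {m : ℕ | r ≤ m ∧
          S.multiplicity n s m + S.multiplicity (n - 1) (s - m) m ≠ 0}.Finite ∧
        Module.finrank F (C.page r n s) =
          S.multiplicity n s ⊤ +
            ∑ᶠ (m : ℕ) (_ : r ≤ m),
              (S.multiplicity n s m + S.multiplicity (n - 1) (s - m) m) := by
  have hX : ∀ n p, FiniteDimensional F (C.persistentComplex.X n p) := fun n p => hfin n p
  have hH : ∀ n p, FiniteDimensional F (C.persistentComplex.homology.X n p) := fun n p =>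
    Module.Finite.of_surjective (C.persistentComplex.homologyMk n p)
      (C.persistentComplex.homologyMk_surjective n p)
  constructor
  · choose p₀ hp₀ using hbdd
    refine ElementarySequence.exists_decomposes (M := C.persistentComplex.homology) p₀ ?_
    intro n p hp
    have hbot : C.fil n p = ⊥ := le_bot_iff.1 ((C.mono n hp).trans (hp₀ n).le)
    have : Subsingleton (C.persistentComplex.X n p) :=
      (Submodule.subsingleton_iff_eq_bot (p := C.fil n p)).2 hbot
    exact (C.persistentComplex.homologyMk_surjective n p).subsingleton
  · intro S hS r hr n s
    obtain ⟨b⟩ := S.decomposes_iff.1 hS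
    obtain ⟨r, rfl⟩ := Nat.exists_eq_add_of_le' hr
    obtain ⟨hT', hpage⟩ := S.finrank_page_eq_ncard C.persistentComplex b r n s
    obtain ⟨h1, h2⟩ := S.ncard_birth (r + 1) n s
    obtain ⟨h3, h4⟩ := S.ncard_death (r + 1) (n - 1) s hT'
    refine ⟨(C.persistentComplex.finrank_page r (n := n) (s := s) (b := s - 1) (c := s - 1 - r)
      (sub_add_cancel n 1) rfl (by push_cast; ring) rfl (by push_cast; ring)).1,
      (h1.union h3).subset ?_, ?_⟩
    · rintro m ⟨hm, hne⟩
      by_cases h : S.multiplicity n s m = 0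
      · exact Or.inr ⟨hm, by simpa [h] using hne⟩
      · exact Or.inl ⟨hm, h⟩
    · refine hpage.trans ?_
      rw [h2, h4, add_assoc]
      congr 1
      -- Both supports must be finite here, since a `finsum` with infinite support is zero by
      -- convention.
      exact (finsum_mem_add_distrib' (s := {m : ℕ | r + 1 ≤ m}) h1 h3).symm
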